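/- **Setting.** Let $D\ge 1$, $a>0$, $0<b\le D-1$, $L,M\ge 0$, $T>0$, $\sigma>0$. Let $\operatorname{Lip}(L,M)$ be the set of $L$-Lipschitz maps $f:\mathbb R^D\to\mathbb R^D$ with $\|f\|\le M$ everywhere ($\|\cdot\|$ Euclidean), $\phi(x,t)$ the flow on $t\ge 0$ of $y'=f(y)$, and $\operatorname{Env}_f(\mathcal X,T)=\{\phi(x,t): x\in\mathcal X,\ t\in[0,T]\}$. Let $\mathcal P(a,b)$ be the set of probability distributions $\mu$ on $\mathbb R^D$ such that $\mu(B(x,R))\ge\min(aR^b,1)$ for all $x\in\operatorname{supp}\mu$ and $R>0$. With $t_j=jT/m$ ($1\le j\le m$), one observes $X_1,\dots,X_n$ and $Y_{i,j}=\phi(X_i,t_j)+\sigma\varepsilon_{i,j}$ ($1\le i\le n$, $1\le j\le m$), where the $X_i$ are i.i.d. with law $\mu\in\mathcal P(a,b)$ and the $\varepsilon_{i,j}$ are i.i.d. standard Gaussian vectors of $\mathbb R^D$, independent of the $X_i$. **Estimator.** (1) $\hat\phi(z,t)=\frac1{k_1k_2}\sum Y_{i,j}$, the sum being over the indices $i$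 of the $k_1$ nearest neighbours of $z$ among $X_1,\dots,X_{\lfloor n/2\rfloor}$ and the indices $j$ of the $k_2$ nearest neighbours of $t$ among $t_1,\dots,t_m$. (2) For $\lfloor n/2\rfloor<i\le n$ and $k+1\le j\le m-k-1$, $$\hat g_{i,j}=\sum_{l=1}^k w_l\,\frac{Y_{i,j+l}-Y_{i,j-l}}{t_{j+l}-t_{j-l}},\qquad w_l=\frac{6l^2}{k(k+1)(2k+1)}.$$ (3) For $x\in\mathbb R^D$ let $i_1(x),\dots,i_r(x)$ be successive minimizers, over the indices $\lfloor n/2\rfloor<i\le n$ not yet chosen, of $\min_{k+1\le j\le m-k-1}\|\hat\phi(X_i,t_j)-x\|$, let $j_l(x)$ minimize $\|\hat\phi(X_{i_l(x)},t_j)-x\|$ over $k+1\le j\le m-k-1$, and put $\hat f(x)=\frac1r\sum_{l=1}^r\hat g_{i_l(x),j_l(x)}$. Ties are broken by any fixed measurable rule which, in (1), depends only on $z$ and the initial values of the first half of the sample (only on $t$ for the time neighbours) and, in (3), only on $x$, all the initial values and the observations of the first half. **Calibration.** Write $k\simeq v$ for $c\,v\le k\le c'\,v$, where $0<c\le c'$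 are fixed. The parameters are positive integers with $$k_1\simeq\max\Big(\tfrac{(n/\ln n)^{3/(b+3)}}{(m/\ln(nm))^{b/(b+3)}},1\Big),\qquad k_2\simeq\max\Big(\tfrac{m^{(b+2)/(b+3)}}{(n/(\ln n\,\ln(nm)))^{1/(b+3)}},1\Big),$$ $$r\simeq\max\Big(\tfrac{n^{5/(5+b)}}{m^{b/(5+b)}},1\Big),\qquad k\simeq\max\Big(\tfrac{m^{(4+b)/(5+b)}}{n^{1/(5+b)}},1\Big).$$ **Theorem 1.** There are a constant $C$ and an integer $N_0$, depending only on $L,M,a,b,D,T,\sigma$ and on the constants $c,c'$ in the calibration, such that for all $n,m\ge N_0$ and all $k_1,k_2,k,r$ calibrated as above, $$\sup_{f\in\operatorname{Lip}(L,M),\ \mu\in\mathcal P(a,b)}\ \sup_{x\in\operatorname{Env}_f(\operatorname{supp}\mu,T)}\mathbb E\big[\|\hat f(x)-f(x)\|\big]\le C\max\Big(\big(\tfrac1{nm}\big)^{\frac1{5+b}},\big(\tfrac{\ln n}{n}\big)^{\frac1b},\tfrac1m\Big).$$ -/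

import Mathlib

open MeasureTheory ProbabilityTheory Set

namespace FlowRegression

/-- The ambient space `ℝ^D` with the Euclidean norm. -/
abbrev Space (D : ℕ) : Type := EuclideanSpace ℝ (Fin D)

noncomputable section

/-! ### Vector field, flow, envelope, initial laws -/

/-- `Lip(L, M)`: the `L`-Lipschitz vector fields on `ℝ^D` whose norm is bounded by `M`. -/
def LipClass (D : ℕ) (L M : NNReal) : Set (Space D → Space D) :=
  {f | LipschitzWith L f ∧ ∀ x, ‖f x‖ ≤ M}

/-- `y` solves `y' = f(y)` on `[0, ∞)` with `y(0) = x`. -/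
def IsSolution {D : ℕ} (f : Space D → Space D) (x : Space D) (y : ℝ → Space D) : Prop :=
  y 0 = x ∧ IsIntegralCurveOn y (fun _ => f) (Ici 0)

open Classical in
/-- The flow `φ(x, t) = y_x(t)`, `t ≥ 0`, of `y' = f(y)`. For `f` in `LipClass` the global solution
exists and is unique on `[0, ∞)`, so the value used where there is none plays no role. -/
def flow {D : ℕ} (f : Space D → Space D) (x : Space D) (t : ℝ) : Space D :=
  if h : ∃ y, IsSolution f x y then h.choose t else x

/-- `Env_f(𝒳, T) = {φ(x, t) : x ∈ 𝒳, t ∈ [0, T]}`. -/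
def envelope {D : ℕ} (f : Space D → Space D) (𝒳 : Set (Space D)) (T : ℝ) : Set (Space D) :=
  {z | ∃ x ∈ 𝒳, ∃ t ∈ Icc 0 T, z = flow f x t}

/-- The class `𝒫(a, b)` of `(a, b)`-standard probability distributions. For `b > 0`, requiring the
inequality for all closed balls or for all open balls is the same. -/
def StandardLaws (D : ℕ) (a b : ℝ) : Set (Measure (Space D)) :=
  {μ | IsProbabilityMeasure μ ∧ ∀ x ∈ μ.support, ∀ R : ℝ, 0 < R →
    ENNReal.ofReal (min (a * R ^ b) 1) ≤ μ (Metric.closedBall x R)}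

/-! ### The sampling model -/

/-- The regular grid on `[0, T]`. Indices start at `0`, so `gridTime T m j = (j + 1) T / m` is the
time called `t_{j+1}` in the numbering `0 < t_1 < ⋯ < t_m = T`. -/
def gridTime (T : ℝ) (m j : ℕ) : ℝ := ((j : ℝ) + 1) * T / m

/-- The initial values `X_i` are i.i.d. with law `μ`, the noise vectors `ε_{i,j}` are i.i.d.
standard Gaussian in `ℝ^D`, and the noise is independent of the initial values. -/
structure IsSample {D n m : ℕ} {Ω : Type*} [MeasurableSpace Ω] (P : Measure Ω)
    (μ : Measure (Space D)) (X : Fin n → Ω → Space D) (ε : Fin n → Fin m → Ω → Space D) :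
    Prop where
  law_init : ∀ i, HasLaw (X i) μ P
  indep_init : iIndepFun X P
  law_noise : ∀ i j, HasLaw (ε i j) (stdGaussian (Space D)) P
  indep_noise : iIndepFun (fun p : Fin n × Fin m => ε p.1 p.2) P
  indep_init_noise : IndepFun (fun ω i => X i ω) (fun ω i j => ε i j ω) P

/-- The observations `Y_{i,j} = φ(X_i, t_j) + σ ε_{i,j}`, from the values of the `X_i`, `ε_{i,j}`. -/
def observations {D n m : ℕ} (f : Space D → Space D) (T σ : ℝ) (X : Fin n → Space D)
    (ε : Fin n → Fin m → Space D) : Fin n → Fin m → Space D :=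
  fun i j => flow f (X i) (gridTime T m j) + σ • ε i j

/-! ### The estimator -/

/-- The `i`-th index of the first half of the sample, which has `⌊n/2⌋` elements. -/
def fstHalf {n : ℕ} (i : Fin (n / 2)) : Fin n := ⟨i, by omega⟩

/-- The `i`-th index of the second half of the sample, which has `n - ⌊n/2⌋` elements. -/
def sndHalf {n : ℕ} (i : Fin (n - n / 2)) : Fin n := ⟨n / 2 + i, by omega⟩

/-- `s 0, s 1, …, s (k-1)` are successive minimizers of the criterion `d`: each `s p` is an element
of the argmin of `d` over the indices that are not among `s 0, …, s (p-1)`. -/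
def IsSuccessiveArgmin {ι : Type*} {k : ℕ} (d : ι → ℝ) (s : Fin k → ι) : Prop :=
  ∀ p, (∀ q < p, s q ≠ s p) ∧ ∀ i, (∀ q < p, s q ≠ i) → d (s p) ≤ d i

/-- Step 1: the nearest-neighbour estimate of the flow at `(z, t)`. Here `nbr X z` lists the `k₁`
nearest neighbours of `z` among the initial values `X` and `tnbr t` the `k₂` nearest neighbours of
`t` in the grid. -/
def flowEst {D N m k₁ k₂ : ℕ} (nbr : (Fin N → Space D) → Space D → Fin k₁ → Fin N)
    (tnbr : ℝ → Fin k₂ → Fin m) (X : Fin N → Space D) (Y : Fin N → Fin m → Space D)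
    (z : Space D) (t : ℝ) : Space D :=
  ((k₁ : ℝ) * k₂)⁻¹ • ∑ p : Fin k₁, ∑ q : Fin k₂, Y (nbr X z p) (tnbr t q)

/-- The value of a finite family at a natural number (`0` outside the range). -/
def valueAt {D m : ℕ} (y : Fin m → Space D) (j : ℕ) : Space D :=
  if h : j < m then y ⟨j, h⟩ else 0

/-- The weights `w_l = 6 l² / (k (k+1) (2k+1))`. -/
def weight (k l : ℕ) : ℝ := 6 * (l : ℝ) ^ 2 / ((k : ℝ) * (k + 1) * (2 * k + 1))

/-- Step 2: the weighted finite-difference estimate of the derivative, at the grid point of index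
`j`, of a trajectory observed as `y`. It is used for `k ≤ j` and `j + k < m` only. -/
def derivEst {D m : ℕ} (T : ℝ) (k : ℕ) (y : Fin m → Space D) (j : ℕ) : Space D :=
  ∑ l ∈ Finset.Icc 1 k,
    weight k l • ((gridTime T m (j + l) - gridTime T m (j - l))⁻¹ •
      (valueAt y (j + l) - valueAt y (j - l)))

/-- The grid points `t_{k+1}, …, t_{m-k-1}` (the index `j` stands for `t_{j+1}`). -/
def innerGrid (m k : ℕ) : Finset (Fin m) :=
  Finset.univ.filter fun j => k + 1 ≤ (j : ℕ) + 1 ∧ (j : ℕ) + 1 + (k + 1) ≤ m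

/-- The distance from `x` to a discretized trajectory `g`: the minimum of `‖g j - x‖` over the
inner grid. -/
def trajDist {D m : ℕ} (k : ℕ) (g : Fin m → Space D) (x : Space D) : ℝ :=
  ⨅ j : innerGrid m k, ‖g j - x‖

/-- A choice of the elements of the argmins that occur in the estimator, that is a rule for
breaking ties. The neighbours in Step 1 are chosen from the initial values, and the trajectories and
times in Step 3 from the initial values and the observations of the first half of the sample, which
are the data that determine the quantities to be minimized. -/
structure Selection (D n m k₁ k₂ k r : ℕ) (T : ℝ) where
  /-- `k₁` nearest neighbours of a point among the initial values of the first half -/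
  nbr : (Fin (n / 2) → Space D) → Space D → Fin k₁ → Fin (n / 2)
  nbr_spec : ∀ X z, IsSuccessiveArgmin (fun i => ‖X i - z‖) (nbr X z)
  nbr_meas : Measurable fun p : (Fin (n / 2) → Space D) × Space D => nbr p.1 p.2
  /-- `k₂` nearest neighbours of a time in the grid -/
  tnbr : ℝ → Fin k₂ → Fin m
  tnbr_spec : ∀ t, IsSuccessiveArgmin (fun j : Fin m => |gridTime T m j - t|) (tnbr t)
  /-- `r` trajectories of the second half closest to `x`; the arguments are the initial values and
  observations of the first half, the initial values of the second half, and `x` -/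
  traj : (Fin (n / 2) → Space D) → (Fin (n / 2) → Fin m → Space D) →
    (Fin (n - n / 2) → Space D) → Space D → Fin r → Fin (n - n / 2)
  traj_spec : ∀ X Y Z x, IsSuccessiveArgmin
    (fun i => trajDist k (fun j : Fin m => flowEst nbr tnbr X Y (Z i) (gridTime T m j)) x)
    (traj X Y Z x)
  traj_meas : ∀ x, Measurable
    fun p : (Fin (n / 2) → Space D) × (Fin (n / 2) → Fin m → Space D) ×
      (Fin (n - n / 2) → Space D) => traj p.1 p.2.1 p.2.2 x
  /-- the times at which these trajectories are closest to `x` -/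
  time : (Fin (n / 2) → Space D) → (Fin (n / 2) → Fin m → Space D) →
    (Fin (n - n / 2) → Space D) → Space D → Fin r → Fin m
  time_mem : ∀ X Y Z x l, time X Y Z x l ∈ innerGrid m k
  time_spec : ∀ X Y Z x l, ∀ j ∈ innerGrid m k,
    ‖flowEst nbr tnbr X Y (Z (traj X Y Z x l)) (gridTime T m (time X Y Z x l)) - x‖ ≤
      ‖flowEst nbr tnbr X Y (Z (traj X Y Z x l)) (gridTime T m j) - x‖
  time_meas : ∀ x, Measurable
    fun p : (Fin (n / 2) → Space D) × (Fin (n / 2) → Fin m → Space D) ×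
      (Fin (n - n / 2) → Space D) => time p.1 p.2.1 p.2.2 x

/-- Step 3: the estimator `f̂(x)`, as a function of the data `X`, `Y`: the average of the estimated
derivatives at the `r` selected points. -/
def fieldEst {D n m k₁ k₂ k r : ℕ} {T : ℝ} (S : Selection D n m k₁ k₂ k r T)
    (X : Fin n → Space D) (Y : Fin n → Fin m → Space D) (x : Space D) : Space D :=
  let X₁ : Fin (n / 2) → Space D := fun i => X (fstHalf i)
  let Y₁ : Fin (n / 2) → Fin m → Space D := fun i => Y (fstHalf i)
  let Z : Fin (n - n / 2) → Space D := fun i => X (sndHalf i)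
  (r : ℝ)⁻¹ • ∑ l : Fin r, derivEst T k (Y (sndHalf (S.traj X₁ Y₁ Z x l))) (S.time X₁ Y₁ Z x l)

/-! ### Calibration and rate -/

/-- `k ≃ v` with constants `c`, `c'`. -/
def Comparable (c c' : ℝ) (k : ℕ) (v : ℝ) : Prop := c * v ≤ k ∧ k ≤ c' * v

/-- The calibration of the parameters `k₁, k₂, k, r`, up to the constants `c`, `c'`. -/
structure Calibrated (b c c' : ℝ) (n m k₁ k₂ k r : ℕ) : Prop where
  k₁_spec : Comparable c c' k₁ (max
    (((n : ℝ) / Real.log n) ^ (3 / (b + 3)) / ((m : ℝ) / Real.log (n * m)) ^ (b / (b + 3))) 1)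
  k₂_spec : Comparable c c' k₂ (max
    ((m : ℝ) ^ ((b + 2) / (b + 3)) /
      ((n : ℝ) / (Real.log n * Real.log (n * m))) ^ (1 / (b + 3))) 1)
  r_spec : Comparable c c' r (max ((n : ℝ) ^ (5 / (5 + b)) / (m : ℝ) ^ (b / (5 + b))) 1)
  k_spec : Comparable c c' k (max ((m : ℝ) ^ ((4 + b) / (5 + b)) / (n : ℝ) ^ (1 / (5 + b))) 1)

/-- The rate `max((nm)^{-1/(5+b)}, (ln n / n)^{1/b}, 1/m)`. -/
def rate (b : ℝ) (n m : ℕ) : ℝ :=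
  max (max ((1 / ((n : ℝ) * m)) ^ (1 / (5 + b))) ((Real.log n / n) ^ (1 / b))) (1 / (m : ℝ))

end

/-! ### Existence of the flow -/

theorem exists_solution_Icc {D : ℕ} {L M : NNReal} {f : Space D → Space D}
    (hf : f ∈ LipClass D L M) (x : Space D) (N : ℕ) :
    ∃ y : ℝ → Space D, y 0 = x ∧ ∀ t ∈ Icc (0 : ℝ) N, HasDerivWithinAt y (f (y t)) (Icc 0 N) t := by
  have h : IsPicardLindelof (fun _ : ℝ => f)
      (⟨0, le_refl 0, Nat.cast_nonneg N⟩ : Icc (0 : ℝ) N) x (M * N) 0 M L :=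
    { lipschitzOnWith := fun t _ => hf.1.lipschitzOnWith
      continuousOn := fun z _ => continuousOn_const
      norm_le := fun t _ z _ => hf.2 z
      mul_max_le := by simp }
  exact h.exists_eq_forall_mem_Icc_hasDerivWithinAt₀

/-- Two solutions on `[0, N]` with the same initial value agree. -/
theorem solution_unique_Icc {D : ℕ} {L M : NNReal} {f : Space D → Space D}
    (hf : f ∈ LipClass D L M) {y z : ℝ → Space D} {N : ℝ}
    (hy : ∀ t ∈ Icc (0 : ℝ) N, HasDerivWithinAt y (f (y t)) (Icc 0 N) t)
    (hz : ∀ t ∈ Icc (0 : ℝ) N, HasDerivWithinAt z (f (z t)) (Icc 0 N) t)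
    (h0 : y 0 = z 0) : EqOn y z (Icc 0 N) := by
  have key : ∀ {u : ℝ → Space D},
      (∀ t ∈ Icc (0 : ℝ) N, HasDerivWithinAt u (f (u t)) (Icc 0 N) t) →
      ∀ t ∈ Ico (0 : ℝ) N, HasDerivWithinAt u (f (u t)) (Ici t) t := by
    intro u hu t ht
    refine (hu t ⟨ht.1, ht.2.le⟩).mono_of_mem_nhdsWithin ?_
    exact Filter.mem_of_superset (Icc_mem_nhdsGE ht.2) (Icc_subset_Icc_left ht.1)
  exact ODE_solution_unique_of_mem_Icc_right (v := fun _ => f) (s := fun _ => univ) (K := L)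
    (fun t _ => hf.1.lipschitzOnWith) (fun t ht => (hy t ht).continuousWithinAt) (key hy)
    (fun _ _ => mem_univ _) (fun t ht => (hz t ht).continuousWithinAt) (key hz)
    (fun _ _ => mem_univ _) h0

/-- For a bounded Lipschitz vector field the flow is the global solution. -/
theorem flow_isSolution {D : ℕ} {L M : NNReal} {f : Space D → Space D}
    (hf : f ∈ LipClass D L M) (x : Space D) : IsSolution f x (flow f x) := by
  have hex : ∃ y, IsSolution f x y := by
    choose y hy0 hy using exists_solution_Icc hf x
    have agree : ∀ N K : ℕ, N ≤ K → EqOn (y N) (y K) (Icc 0 (N : ℝ)) := by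
      intro N K hNK
      refine solution_unique_Icc hf (hy N) (fun t ht => ?_) ((hy0 N).trans (hy0 K).symm)
      have hs : Icc (0 : ℝ) N ⊆ Icc 0 (K : ℝ) := Icc_subset_Icc_right (by exact_mod_cast hNK)
      exact (hy K t (hs ht)).mono hs
    have glue : ∀ K : ℕ, ∀ t ∈ Icc (0 : ℝ) K, y ⌈t⌉₊ t = y K t := fun K t ht =>
      agree _ K (Nat.ceil_le.2 ht.2) ⟨ht.1, Nat.le_ceil t⟩
    refine ⟨fun t => y ⌈t⌉₊ t, by simp [hy0], fun t ht => ?_⟩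
    have ht0 : (0 : ℝ) ≤ t := ht
    obtain ⟨K, hK⟩ := exists_nat_gt t
    have h1 : HasDerivWithinAt (fun s => y ⌈s⌉₊ s) (f (y K t)) (Icc 0 (K : ℝ)) t :=
      (hy K t ⟨ht0, hK.le⟩).congr (fun s hs => glue K s hs) (glue K t ⟨ht0, hK.le⟩)
    have h2 : y ⌈t⌉₊ t = y K t := glue K t ⟨ht0, hK.le⟩
    simp only [h2]
    refine h1.mono_of_mem_nhdsWithin ?_
    rw [← Ici_inter_Iic]
    exact Filter.inter_mem self_mem_nhdsWithin (mem_nhdsWithin_of_mem_nhds (Iic_mem_nhds hK))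
  have : flow f x = hex.choose := by
    funext t
    simp [flow, hex]
  rw [this]
  exact hex.choose_spec

end FlowRegression

open FlowRegression

namespace FlowRegression

/-! ### Deterministic facts on the flow -/

/-! Write x = φ(x₀, t₀) and let ρ be the rate. The error of the estimator splits into three terms:
the bias of the finite differences along the selected trajectories, the change of f between the
selected true points and x, and the averaged noise.

The finite-difference bias is at most L M k T / m, because f is LM-Lipschitz in time along a
trajectory. The second term is at most L times the distance from x to the selected points. The
minimization controls that distance: if at least r initial values of the second half lie within R of
x₀, their estimated trajectories pass close to x, hence so do the r selected ones
(`norm_flow_selected_sub_le`). The loss is twice the uniform error of the flow estimator, which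
consists of e^{LT} R when every Z_i has k₁ neighbours within R, a time bias of order k₂/m, and a
Gaussian noise. When points are too scarce, the crude bound 2M is charged to an exponential majorant
of that event, so the whole estimate is one pointwise inequality (`norm_splitEst_sub_le`) and no
conditioning on a good event is needed.

It remains to integrate. Sample splitting makes the selected indices independent of the second-half
noise, so the noise in f̂ is, with the other data fixed, a Gaussian combination of distinct entries
with deviation of order m / (T √(r k³)). The neighbours used by the flow estimator depend on the
initial values only, so its noise is a maximum of at most nm Gaussian vectors of variance 1/(k₁k₂),
costing √(ln(nm)). The scarcity majorant is handled by a Chernoff bound using the (a, b)-standard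
mass of balls.

With R proportional to ρ, a ball holds about nρ^b ≥ ln n points, enough for r and k₁. The
calibration makes k/m, k₂/m and both noise levels at most a constant times ρ. The flow estimator has
its own rate, with exponent 1/(b+3) and logarithms, which is dominated by (nm)^{-1/(5+b)}. -/

theorem IsSuccessiveArgmin.injective {ι : Type*} {k : ℕ} {d : ι → ℝ} {s : Fin k → ι}
    (h : IsSuccessiveArgmin d s) : Function.Injective s := by
  intro p q hpq
  rcases lt_trichotomy p q with hlt | heq | hgt
  · exact absurd hpq ((h q).1 p hlt)
  · exact heq
  · exact absurd hpq.symm ((h p).1 q hgt)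

/-- If at least `k` indices have criterion at most `ρ`, so have `k` successive minimizers. -/
theorem IsSuccessiveArgmin.le_of_card {ι : Type*} {k : ℕ} {d : ι → ℝ} {s : Fin k → ι}
    (h : IsSuccessiveArgmin d s) {A : Finset ι} (hA : k ≤ A.card) {ρ : ℝ}
    (hd : ∀ i ∈ A, d i ≤ ρ) (p : Fin k) : d (s p) ≤ ρ := by
  classical
  -- Pigeonhole: fewer than k indices are already taken, so some element of A is still a competitor
  -- of s p.
  have hcard : ((Finset.univ.filter (· < p)).image s).card < A.card := by
    refine lt_of_le_of_lt Finset.card_image_le ?_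
    rw [show Finset.univ.filter (· < p) = Finset.Iio p by ext; simp, Fin.card_Iio]
    omega
  obtain ⟨i, hiA, hi⟩ := Finset.exists_mem_notMem_of_card_lt_card hcard
  refine ((h p).2 i fun q hq hqi => hi ?_).trans (hd i hiA)
  exact Finset.mem_image.2 ⟨q, by simpa using hq, hqi⟩

variable {D : ℕ} {L M : NNReal} {f : Space D → Space D}

theorem flow_zero (hf : f ∈ LipClass D L M) (x : Space D) : flow f x 0 = x :=
  (flow_isSolution hf x).1

theorem hasDerivWithinAt_flow (hf : f ∈ LipClass D L M) (x : Space D) {t : ℝ} (ht : 0 ≤ t) :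
    HasDerivWithinAt (flow f x) (f (flow f x t)) (Ici 0) t :=
  (flow_isSolution hf x).2 t ht

theorem norm_flow_sub_flow_le (hf : f ∈ LipClass D L M) (x y : Space D) {t T : ℝ} (ht : 0 ≤ t)
    (htT : t ≤ T) : ‖flow f x t - flow f y t‖ ≤ Real.exp (L * T) * ‖x - y‖ := by
  have h := dist_le_of_trajectories_ODE (v := fun _ => f) (K := L) (f := flow f x) (g := flow f y)
    (a := 0) (b := t) (δ := ‖x - y‖) (fun _ => hf.1)
    (fun s hs => ((hasDerivWithinAt_flow hf x hs.1).mono Icc_subset_Ici_self).continuousWithinAt)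
    (fun s hs => (hasDerivWithinAt_flow hf x hs.1).mono (Ici_subset_Ici.2 hs.1))
    (fun s hs => ((hasDerivWithinAt_flow hf y hs.1).mono Icc_subset_Ici_self).continuousWithinAt)
    (fun s hs => (hasDerivWithinAt_flow hf y hs.1).mono (Ici_subset_Ici.2 hs.1))
    (by rw [flow_zero hf, flow_zero hf, dist_eq_norm]) t ⟨ht, le_rfl⟩
  rw [dist_eq_norm, sub_zero, mul_comm] at h
  refine h.trans ?_
  gcongr

theorem norm_flow_time_sub_le (hf : f ∈ LipClass D L M) (x : Space D) {s t : ℝ} (hs : 0 ≤ s)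
    (ht : 0 ≤ t) : ‖flow f x t - flow f x s‖ ≤ M * |t - s| :=
  Convex.norm_image_sub_le_of_norm_hasDerivWithin_le (s := Ici (0 : ℝ))
    (f' := fun u => f (flow f x u)) (fun _ hu => hasDerivWithinAt_flow hf x hu)
    (fun _ _ => hf.2 _) (convex_Ici 0) hs ht

theorem continuous_flow (hf : f ∈ LipClass D L M) {t : ℝ} (ht : 0 ≤ t) :
    Continuous fun x => flow f x t := by
  refine (LipschitzWith.of_dist_le_mul (K := ⟨Real.exp (L * t), (Real.exp_pos _).le⟩)
    fun x y => ?_).continuous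
  rw [dist_eq_norm, dist_eq_norm]
  exact norm_flow_sub_flow_le hf x y ht le_rfl

/-- Error of the symmetric finite difference. -/
theorem norm_flow_symm_diff_sub_le (hf : f ∈ LipClass D L M) (x : Space D) {t h : ℝ} (hh : 0 < h)
    (ht : 0 ≤ t - h) :
    ‖(2 * h)⁻¹ • (flow f x (t + h) - flow f x (t - h)) - f (flow f x t)‖ ≤ L * M * h := by
  set v := f (flow f x t) with hv
  have hsub : Icc (t - h) (t + h) ⊆ Ici 0 := fun s hs => ht.trans hs.1
  -- Mean value inequality for φ(x, s) - s v on [t - h, t + h], whose derivative f(φ(x, s)) - v is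
  -- at most L M h.
  have key : ‖(flow f x (t + h) - (t + h) • v) - (flow f x (t - h) - (t - h) • v)‖
      ≤ L * M * h * ‖(t + h) - (t - h)‖ := by
    refine Convex.norm_image_sub_le_of_norm_hasDerivWithin_le (s := Icc (t - h) (t + h))
      (f := fun s => flow f x s - s • v) (f' := fun s => f (flow f x s) - (1 : ℝ) • v)
      (fun s hs => ?_) (fun s hs => ?_) (convex_Icc _ _)
      ⟨le_rfl, by linarith⟩ ⟨by linarith, le_rfl⟩
    · exact ((hasDerivWithinAt_flow hf x (hsub hs)).mono hsub).sub
        ((hasDerivWithinAt_id s _).smul_const v)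
    · rw [one_smul, hv]
      have h1 := hf.1.norm_sub_le (flow f x s) (flow f x t)
      have h2 := norm_flow_time_sub_le hf x (s := t) (t := s) (by linarith) (hsub hs)
      have h3 : |s - t| ≤ h := abs_le.2 ⟨by linarith [hs.1], by linarith [hs.2]⟩
      calc _ ≤ (L : ℝ) * ‖flow f x s - flow f x t‖ := h1
        _ ≤ L * (M * h) := by gcongr; exact h2.trans (by gcongr)
        _ = _ := by ring
  have e : (2 * h)⁻¹ • (flow f x (t + h) - flow f x (t - h)) - v
      = (2 * h)⁻¹ • ((flow f x (t + h) - (t + h) • v) - (flow f x (t - h) - (t - h) • v)) := by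
    have : (flow f x (t + h) - (t + h) • v) - (flow f x (t - h) - (t - h) • v)
        = (flow f x (t + h) - flow f x (t - h)) - (2 * h) • v := by module
    rw [this, smul_sub _ _ ((2 * h) • v), smul_smul, inv_mul_cancel₀ (by positivity), one_smul]
  rw [e, norm_smul, norm_inv, Real.norm_of_nonneg (by positivity : (0 : ℝ) ≤ 2 * h)]
  have : ‖(t + h) - (t - h)‖ = 2 * h := by
    rw [show (t + h) - (t - h) = 2 * h by ring, Real.norm_of_nonneg (by positivity)]
  rw [this] at key
  rw [inv_mul_le_iff₀ (by positivity)]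
  linarith

/-! ### The grid and the weights -/

theorem gridTime_nonneg {T : ℝ} (hT : 0 < T) (m j : ℕ) : 0 ≤ gridTime T m j := by
  unfold gridTime; positivity

theorem gridTime_le {T : ℝ} (hT : 0 < T) {m j : ℕ} (hj : j < m) : gridTime T m j ≤ T := by
  unfold gridTime
  rw [div_le_iff₀ (by exact_mod_cast (by omega : 0 < m)), mul_comm T]
  have : (j : ℝ) + 1 ≤ m := by exact_mod_cast hj
  gcongr

theorem gridTime_sub (T : ℝ) (m i j : ℕ) :
    gridTime T m i - gridTime T m j = ((i : ℝ) - j) * (T / m) := by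
  unfold gridTime; ring

theorem sum_sq_Icc (k : ℕ) :
    6 * ∑ l ∈ Finset.Icc 1 k, (l : ℝ) ^ 2 = (k : ℝ) * (k + 1) * (2 * k + 1) := by
  induction k with
  | zero => simp
  | succ k ih =>
    rw [Finset.sum_Icc_succ_top (by omega), mul_add, ih]
    push_cast; ring

theorem sum_weight {k : ℕ} (hk : 0 < k) : ∑ l ∈ Finset.Icc 1 k, weight k l = 1 := by
  unfold weight
  rw [← Finset.sum_div, ← Finset.mul_sum, sum_sq_Icc, div_self]
  positivity

theorem weight_nonneg (k l : ℕ) : 0 ≤ weight k l := by unfold weight; positivity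

theorem valueAt_of_lt {m : ℕ} (y : Fin m → Space D) {j : ℕ} (h : j < m) :
    valueAt y j = y ⟨j, h⟩ := by simp [valueAt, h]

theorem valueAt_add_smul {m : ℕ} (y e : Fin m → Space D) (σ : ℝ) (j : ℕ) :
    valueAt (fun i => y i + σ • e i) j = valueAt y j + σ • valueAt e j := by
  unfold valueAt; split_ifs <;> simp

theorem derivEst_add_smul {m : ℕ} (T : ℝ) (k : ℕ) (y e : Fin m → Space D) (σ : ℝ) (j : ℕ) :
    derivEst T k (fun i => y i + σ • e i) j = derivEst T k y j + σ • derivEst T k e j := by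
  unfold derivEst
  rw [Finset.smul_sum, ← Finset.sum_add_distrib]
  refine Finset.sum_congr rfl fun l _ => ?_
  rw [valueAt_add_smul, valueAt_add_smul]
  module

/-- The weights are nonnegative with sum 1, so the estimate is a convex combination of symmetric
differences of half-widths l T/m ≤ k T/m, each with bias at most L M l T/m. -/
theorem norm_derivEst_flow_sub_le (hf : f ∈ LipClass D L M) {T : ℝ} (hT : 0 < T) {m k : ℕ}
    (hk : 0 < k) (x : Space D) {j : ℕ} (hkj : k ≤ j) (hjm : j + k < m) :
    ‖derivEst T k (fun i : Fin m => flow f x (gridTime T m i)) j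
      - f (flow f x (gridTime T m j))‖ ≤ L * M * (k * (T / m)) := by
  have hm : (0 : ℝ) < m := by exact_mod_cast (by omega : 0 < m)
  set v := f (flow f x (gridTime T m j)) with hv
  have hdecomp : derivEst T k (fun i : Fin m => flow f x (gridTime T m i)) j - v
      = ∑ l ∈ Finset.Icc 1 k, weight k l • ((2 * (l * (T / m)))⁻¹ •
        (flow f x (gridTime T m j + l * (T / m)) - flow f x (gridTime T m j - l * (T / m))) - v) := by
    conv_lhs => rw [← one_smul ℝ v, ← sum_weight hk, Finset.sum_smul]
    unfold derivEst
    rw [← Finset.sum_sub_distrib]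
    refine Finset.sum_congr rfl fun l hl => ?_
    rw [Finset.mem_Icc] at hl
    rw [← smul_sub, valueAt_of_lt _ (by omega), valueAt_of_lt _ (by omega), gridTime_sub]
    have h1 : gridTime T m (j + l) = gridTime T m j + l * (T / m) := by
      have := gridTime_sub T m (j + l) j
      push_cast at this
      linarith
    have h2 : gridTime T m (j - l) = gridTime T m j - l * (T / m) := by
      have := gridTime_sub T m (j - l) j
      rw [Nat.cast_sub (by omega)] at this
      linarith
    simp only [h1, h2]
    rw [Nat.cast_sub (by omega)]
    rw [show ((j + l : ℕ) : ℝ) - (j - l) = 2 * l by push_cast; ring, mul_assoc]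
  rw [hdecomp]
  calc _ ≤ ∑ l ∈ Finset.Icc 1 k, weight k l * (L * M * (k * (T / m))) := by
        refine norm_sum_le_of_le _ fun l hl => ?_
        rw [Finset.mem_Icc] at hl
        have hl0 : (0 : ℝ) < l := by exact_mod_cast hl.1
        have hlk : (l : ℝ) ≤ k := by exact_mod_cast hl.2
        rw [norm_smul, Real.norm_of_nonneg (weight_nonneg k l)]
        refine mul_le_mul_of_nonneg_left ?_ (weight_nonneg k l)
        refine (norm_flow_symm_diff_sub_le hf x (by positivity) ?_).trans (by gcongr)
        have h2 : gridTime T m j - l * (T / m) = ((j : ℝ) + 1 - l) * (T / m) := by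
          unfold gridTime; ring
        have : (l : ℝ) ≤ j := by exact_mod_cast (by omega : l ≤ j)
        rw [h2]
        exact mul_nonneg (by linarith) (by positivity)
    _ = _ := by rw [← Finset.sum_mul, sum_weight hk, one_mul]

/-- A point of the inner grid close to a given time. -/
theorem exists_innerGrid_near {T : ℝ} (hT : 0 < T) {m k : ℕ} (hmk : 2 * k + 2 ≤ m) {t : ℝ}
    (ht : t ∈ Icc 0 T) :
    ∃ j ∈ innerGrid m k, |gridTime T m (j : Fin m) - t| ≤ (k + 2) * (T / m) := by
  have hm : (0 : ℝ) < m := by exact_mod_cast (by omega : 0 < m)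
  set u := t * m / T with hu
  have hu0 : 0 ≤ u := by have := ht.1; positivity
  have hum : u ≤ m := by
    rw [hu, div_le_iff₀ hT, mul_comm]
    exact mul_le_mul_of_nonneg_left ht.2 hm.le
  have htu : t = u * (T / m) := by rw [hu]; field_simp
  have hfl := Nat.floor_le hu0
  have hlt := Nat.lt_floor_add_one u
  have hflm : ⌊u⌋₊ ≤ m := Nat.floor_le_of_le hum
  set q := ⌊u⌋₊
  -- The time number j + 1 is q clamped to [k + 1, m - k - 1]; clamping moves q by at most k + 1,
  -- and the floor costs one more step.
  obtain ⟨j, hj1, hj2, hj3, hj4⟩ : ∃ j : ℕ, k ≤ j ∧ j + k + 2 ≤ m ∧ j + 1 ≤ q + k + 1 ∧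
      q ≤ j + 1 + (k + 1) := by
    by_cases h1 : q ≤ k
    · exact ⟨k, by omega⟩
    · by_cases h2 : q + k + 1 ≤ m
      · exact ⟨q - 1, by omega⟩
      · exact ⟨m - k - 2, by omega⟩
  refine ⟨⟨j, by omega⟩, by simp [innerGrid]; omega, ?_⟩
  have e : gridTime T m j - t = ((j : ℝ) + 1 - u) * (T / m) := by
    rw [htu]; unfold gridTime; ring
  have h3 : (j : ℝ) + 1 ≤ q + k + 1 := by exact_mod_cast hj3
  have h4 : (q : ℝ) ≤ j + 1 + (k + 1) := by exact_mod_cast hj4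
  change |gridTime T m j - t| ≤ _
  rw [e, abs_mul, abs_of_pos (by positivity : 0 < T / m)]
  gcongr
  exact abs_le.2 ⟨by linarith, by linarith⟩

/-- There are at least `k` grid points within `k` steps of a grid point. -/
theorem card_near_grid {m k : ℕ} (hk : k ≤ m) (j : Fin m) :
    k ≤ (Finset.univ.filter fun i : Fin m => (i : ℕ) ≤ j + k ∧ (j : ℕ) ≤ i + k).card := by
  have hj := j.2
  -- A window of k consecutive indices that stays in the grid: it starts at j, or is pushed back to
  -- end at the last index.
  obtain ⟨a, ha1, ha2, ha3⟩ : ∃ a : ℕ, a + k ≤ m ∧ a ≤ j ∧ (j : ℕ) ≤ a + k := by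
    by_cases h : (j : ℕ) + k ≤ m
    · exact ⟨j, h, le_rfl, by omega⟩
    · exact ⟨m - k, by omega⟩
  have hinj : Function.Injective fun q : Fin k => (⟨a + q, by omega⟩ : Fin m) := by
    intro p q h
    simp only [Fin.mk.injEq] at h
    exact Fin.ext (by omega)
  calc k = ((Finset.univ : Finset (Fin k)).image
        fun q : Fin k => (⟨a + q, by omega⟩ : Fin m)).card := by
        rw [Finset.card_image_of_injective _ hinj]; simp
    _ ≤ _ := by
        refine Finset.card_le_card fun i hi => ?_
        obtain ⟨q, -, rfl⟩ := Finset.mem_image.1 hi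
        simp only [Finset.mem_filter, Finset.mem_univ, true_and]
        omega

theorem abs_gridTime_sub_le_of_selection {T : ℝ} (hT : 0 < T) {m k : ℕ} {s : Fin k → Fin m}
    (j : Fin m) (hs : IsSuccessiveArgmin (fun i : Fin m => |gridTime T m i - gridTime T m j|) s)
    (q : Fin k) : |gridTime T m (s q) - gridTime T m j| ≤ k * (T / m) := by
  have hk : k ≤ m := by simpa using Fintype.card_le_of_injective s hs.injective
  refine hs.le_of_card (card_near_grid hk j) (fun i hi => ?_) q
  simp only [Finset.mem_filter, Finset.mem_univ, true_and] at hi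
  have h1 : (i : ℝ) ≤ j + k := by exact_mod_cast hi.1
  have h2 : (j : ℝ) ≤ i + k := by exact_mod_cast hi.2
  rw [gridTime_sub, abs_mul, abs_of_nonneg (by positivity : 0 ≤ T / m)]
  gcongr
  exact abs_le.2 ⟨by linarith, by linarith⟩

end FlowRegression

namespace FlowRegression

/-! ### Product laws -/

/-- Integral of a product of functions of distinct coordinates. -/
theorem lintegral_prod_comp_coord {ι J E : Type*} [Fintype ι] [Fintype J] [MeasurableSpace E]
    (μ : Measure E) [IsProbabilityMeasure μ] {idx : J → ι} (hidx : Function.Injective idx)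
    {g : J → E → ENNReal} (hg : ∀ α, Measurable (g α)) :
    ∫⁻ e, ∏ α, g α (e (idx α)) ∂(Measure.pi fun _ : ι => μ) = ∏ α, ∫⁻ u, g α u ∂μ := by
  have h0 : iIndepFun (fun (i : ι) (e : ι → E) => e i) (Measure.pi fun _ : ι => μ) :=
    iIndepFun_pi (X := fun _ u => u) fun _ => aemeasurable_id
  have h := lintegral_prod_eq_prod_lintegral_of_indepFun Finset.univ
    (fun α (e : ι → E) => g α (e (idx α)))
    ((h0.precomp hidx).comp g hg) (fun α => (hg α).comp (measurable_pi_apply _))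
  rw [h]
  refine Finset.prod_congr rfl fun α _ => ?_
  exact (measurePreserving_eval (fun _ : ι => μ) (idx α)).lintegral_comp (hg α)

/-- Two disjoint subfamilies of an i.i.d. family are jointly distributed as a product. -/
theorem hasLaw_prodMk_pi {ι κ₁ κ₂ E Ω : Type*} [Fintype κ₁] [Fintype κ₂] [MeasurableSpace E]
    [MeasurableSpace Ω] {P : Measure Ω} {μ : Measure E} [IsProbabilityMeasure μ]
    {X : ι → Ω → E} (hX : ∀ i, HasLaw (X i) μ P) (hi : iIndepFun X P) {g : κ₁ ⊕ κ₂ → ι}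
    (hg : Function.Injective g) :
    HasLaw (fun ω => ((fun a => X (g (.inl a)) ω), (fun b => X (g (.inr b)) ω)))
      ((Measure.pi fun _ : κ₁ => μ).prod (Measure.pi fun _ : κ₂ => μ)) P := by
  have h1 : HasLaw (fun ω s => X (g s) ω) (Measure.pi fun _ : κ₁ ⊕ κ₂ => μ) P :=
    (hi.precomp hg).hasLaw_pi fun s => hX (g s)
  exact (measurePreserving_sumPiEquivProdPi fun _ : κ₁ ⊕ κ₂ => μ).hasLaw.comp h1

/-! ### Gaussian vectors -/

variable {D : ℕ}

theorem hasLaw_coord_stdGaussian (d : Fin D) :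
    HasLaw (fun u : Space D => u d) (gaussianReal 0 1) (stdGaussian (Space D)) where
  aemeasurable := by fun_prop
  map_eq := by
    rw [← map_pi_eq_stdGaussian, Measure.map_map (by fun_prop) (by fun_prop)]
    exact (measurePreserving_eval (fun _ : Fin D => gaussianReal 0 1) d).map_eq

theorem lintegral_exp_coord_stdGaussian (d : Fin D) (t : ℝ) :
    ∫⁻ u : Space D, ENNReal.ofReal (Real.exp (t * u d)) ∂(stdGaussian (Space D))
      = ENNReal.ofReal (Real.exp (t ^ 2 / 2)) := by
  rw [(hasLaw_coord_stdGaussian d).lintegral_comp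
    (f := fun y => ENNReal.ofReal (Real.exp (t * y))) (by fun_prop),
    ← ofReal_integral_eq_lintegral_ofReal (integrable_exp_mul_gaussianReal t)
      (Filter.Eventually.of_forall fun _ => (Real.exp_pos _).le)]
  have h := congrFun (mgf_fun_id_gaussianReal (μ := 0) (v := 1)) t
  rw [mgf] at h
  rw [h]
  simp

/-- Linear combination of distinct entries of a family of vectors. -/
noncomputable def linComb {ι J : Type*} [Fintype J] (idx : J → ι) (c : J → ℝ) (e : ι → Space D) :
    Space D := ∑ α, c α • e (idx α)

/-- Injectivity of `idx` makes the terms independent, so the moment generating function factors. -/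
theorem lintegral_exp_linComb {ι J : Type*} [Fintype ι] [Fintype J] {idx : J → ι}
    (hidx : Function.Injective idx) (c : J → ℝ) (d : Fin D) (t : ℝ) :
    ∫⁻ e, ENNReal.ofReal (Real.exp (t * linComb idx c e d))
        ∂(Measure.pi fun _ : ι => stdGaussian (Space D))
      = ENNReal.ofReal (Real.exp (t ^ 2 / 2 * ∑ α, c α ^ 2)) := by
  have h := lintegral_prod_comp_coord (stdGaussian (Space D)) hidx
    (g := fun α u => ENNReal.ofReal (Real.exp (t * c α * u d))) (fun α => by fun_prop)
  simp_rw [lintegral_exp_coord_stdGaussian] at h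
  rw [← ENNReal.ofReal_prod_of_nonneg (fun _ _ => (Real.exp_pos _).le), ← Real.exp_sum] at h
  have e1 : ∀ e : ι → Space D, ENNReal.ofReal (Real.exp (t * linComb idx c e d))
      = ∏ α, ENNReal.ofReal (Real.exp (t * c α * e (idx α) d)) := by
    intro e
    rw [← ENNReal.ofReal_prod_of_nonneg (fun _ _ => (Real.exp_pos _).le), ← Real.exp_sum]
    simp [linComb, Finset.mul_sum, mul_assoc]
  simp_rw [e1]
  rw [h, Finset.mul_sum]
  congr 3
  funext α
  ring

/-- An exponential majorant of the norm of a vector. -/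
noncomputable def expNorm (t : ℝ) (u : Space D) : ℝ :=
  ∑ d, (Real.exp (t * u d) + Real.exp (-t * u d))

theorem expNorm_nonneg (t : ℝ) (u : Space D) : 0 ≤ expNorm t u :=
  Finset.sum_nonneg fun _ _ => by positivity

theorem measurable_expNorm (t : ℝ) : Measurable (expNorm (D := D) t) := by
  unfold expNorm; fun_prop

theorem norm_le_sum_abs (u : Space D) : ‖u‖ ≤ ∑ d, |u d| := by
  rw [EuclideanSpace.norm_eq]
  refine Real.sqrt_le_iff.2 ⟨Finset.sum_nonneg fun _ _ => abs_nonneg _, ?_⟩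
  simpa using Finset.sum_sq_le_sq_sum_of_nonneg (s := Finset.univ) (f := fun d => |u d|)
    fun _ _ => abs_nonneg _

/-- Coordinatewise, 1 + y ≤ e^y at y = t(|u_d| - s) gives |u_d| ≤ s + t⁻¹ e^{t(|u_d| - s)}. The
threshold s is free: 0 suffices for a single vector, and a positive value pays for a maximum over
many. -/
theorem norm_le_expNorm {t : ℝ} (ht : 0 < t) (s : ℝ) (u : Space D) :
    ‖u‖ ≤ D * s + t⁻¹ * Real.exp (-(t * s)) * expNorm t u := by
  have h : ∀ d, |u d| ≤ s + t⁻¹ * Real.exp (-(t * s)) * (Real.exp (t * u d) + Real.exp (-t * u d)) := by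
    intro d
    have h1 : Real.exp (t * |u d|) ≤ Real.exp (t * u d) + Real.exp (-t * u d) := by
      rcases abs_cases (u d) with ⟨h, -⟩ | ⟨h, -⟩ <;> rw [h]
      · exact le_add_of_nonneg_right (Real.exp_pos _).le
      · rw [mul_neg, neg_mul]
        exact le_add_of_nonneg_left (Real.exp_pos _).le
    have h2 : t * |u d| - t * s ≤ Real.exp (-(t * s)) * Real.exp (t * |u d|) := by
      rw [← Real.exp_add]
      have := Real.add_one_le_exp (-(t * s) + t * |u d|)
      linarith
    have h3 : |u d| - s ≤ t⁻¹ * (Real.exp (-(t * s)) * Real.exp (t * |u d|)) := by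
      rw [le_inv_mul_iff₀ ht]; linarith
    have h4 : t⁻¹ * (Real.exp (-(t * s)) * Real.exp (t * |u d|))
        ≤ t⁻¹ * (Real.exp (-(t * s)) * (Real.exp (t * u d) + Real.exp (-t * u d))) := by gcongr
    linarith
  refine (norm_le_sum_abs u).trans ((Finset.sum_le_sum fun d _ => h d).trans ?_)
  rw [Finset.sum_add_distrib, ← Finset.mul_sum]
  simp [expNorm]

theorem lintegral_expNorm_linComb {ι J : Type*} [Fintype ι] [Fintype J] {idx : J → ι}
    (hidx : Function.Injective idx) (c : J → ℝ) (t : ℝ) :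
    ∫⁻ e, ENNReal.ofReal (expNorm t (linComb idx c e))
        ∂(Measure.pi fun _ : ι => stdGaussian (Space D))
      = ENNReal.ofReal (2 * D * Real.exp (t ^ 2 / 2 * ∑ α, c α ^ 2)) := by
  have hm : Measurable fun e : ι → Space D => linComb idx c e := by
    unfold linComb; fun_prop
  have e1 : ∀ e : ι → Space D, ENNReal.ofReal (expNorm t (linComb idx c e))
      = ∑ d, (ENNReal.ofReal (Real.exp (t * linComb idx c e d))
        + ENNReal.ofReal (Real.exp (-t * linComb idx c e d))) := by
    intro e
    unfold expNorm
    rw [ENNReal.ofReal_sum_of_nonneg fun _ _ => by positivity]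
    exact Finset.sum_congr rfl fun d _ =>
      ENNReal.ofReal_add (Real.exp_pos _).le (Real.exp_pos _).le
  simp_rw [e1]
  rw [lintegral_finsetSum _ fun d _ => by fun_prop]
  have e2 : ∀ d : Fin D, ∫⁻ e, (ENNReal.ofReal (Real.exp (t * linComb idx c e d))
        + ENNReal.ofReal (Real.exp (-t * linComb idx c e d)))
        ∂(Measure.pi fun _ : ι => stdGaussian (Space D))
      = ENNReal.ofReal (2 * Real.exp (t ^ 2 / 2 * ∑ α, c α ^ 2)) := by
    intro d
    rw [lintegral_add_left (by fun_prop), lintegral_exp_linComb hidx, lintegral_exp_linComb hidx,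
      ← ENNReal.ofReal_add (Real.exp_pos _).le (Real.exp_pos _).le, neg_sq, two_mul]
  simp_rw [e2]
  rw [← ENNReal.ofReal_sum_of_nonneg fun _ _ => by positivity]
  congr 1
  simp; ring

/-- First moment of a Gaussian vector. -/
theorem lintegral_norm_linComb_le {ι J : Type*} [Fintype ι] [Fintype J] {idx : J → ι}
    (hidx : Function.Injective idx) (c : J → ℝ) {w : ℝ} (hw : 0 < w)
    (hc : ∑ α, c α ^ 2 ≤ w ^ 2) :
    ∫⁻ e, ENNReal.ofReal ‖linComb idx c e‖ ∂(Measure.pi fun _ : ι => stdGaussian (Space D))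
      ≤ ENNReal.ofReal (4 * D * w) := by
  have h1 : ∀ e : ι → Space D, ENNReal.ofReal ‖linComb idx c e‖
      ≤ ENNReal.ofReal w * ENNReal.ofReal (expNorm w⁻¹ (linComb idx c e)) := by
    intro e
    rw [← ENNReal.ofReal_mul hw.le]
    refine ENNReal.ofReal_le_ofReal ?_
    simpa using norm_le_expNorm (inv_pos.2 hw) 0 (linComb idx c e)
  refine (lintegral_mono h1).trans ?_
  rw [lintegral_const_mul' _ _ ENNReal.ofReal_ne_top, lintegral_expNorm_linComb hidx,
    ← ENNReal.ofReal_mul hw.le]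
  refine ENNReal.ofReal_le_ofReal ?_
  -- At t = 1/w the exponent is at most 1/2 < ln 2, which yields the constant 4.
  have h2 : w⁻¹ ^ 2 / 2 * ∑ α, c α ^ 2 ≤ Real.log 2 := by
    calc w⁻¹ ^ 2 / 2 * ∑ α, c α ^ 2 ≤ w⁻¹ ^ 2 / 2 * w ^ 2 := by gcongr
      _ = 1 / 2 := by field_simp
      _ ≤ Real.log 2 := by linarith [Real.log_two_gt_d9]
  have h3 : Real.exp (w⁻¹ ^ 2 / 2 * ∑ α, c α ^ 2) ≤ 2 :=
    (Real.exp_le_exp.2 h2).trans_eq (Real.exp_log two_pos)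
  calc w * (2 * D * Real.exp (w⁻¹ ^ 2 / 2 * ∑ α, c α ^ 2)) ≤ w * (2 * D * 2) := by gcongr
    _ = _ := by ring

end FlowRegression

/-! ### Maxima of Gaussian vectors. -/

namespace FlowRegression

variable {D : ℕ}

/-- A majorant of the norms of finitely many Gaussian vectors. -/
noncomputable def noiseMaj {𝒯 : Type*} [Fintype 𝒯] (w q : ℝ) (V : 𝒯 → Space D) : ℝ :=
  D * (2 * q * w) + (q / w)⁻¹ * Real.exp (-(q / w * (2 * q * w))) * ∑ τ, expNorm (q / w) (V τ)

/-- This is `norm_le_expNorm` with t = q/w and s = 2qw, one exponential term being bounded by the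
sum over the family. Here w stands for a deviation and e^{q²} for the size of the family. -/
theorem norm_le_noiseMaj {𝒯 : Type*} [Fintype 𝒯] {w q : ℝ} (hw : 0 < w) (hq : 0 < q)
    (V : 𝒯 → Space D) (τ : 𝒯) : ‖V τ‖ ≤ noiseMaj w q V := by
  refine (norm_le_expNorm (div_pos hq hw) (2 * q * w) (V τ)).trans ?_
  unfold noiseMaj
  gcongr
  exact Finset.single_le_sum (f := fun τ => expNorm (q / w) (V τ))
    (fun _ _ => expNorm_nonneg _ _) (Finset.mem_univ τ)

theorem noiseMaj_nonneg {𝒯 : Type*} [Fintype 𝒯] {w q : ℝ} (hw : 0 < w) (hq : 0 < q)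
    (V : 𝒯 → Space D) : 0 ≤ noiseMaj w q V :=
  add_nonneg (by positivity) (mul_nonneg (by positivity)
    (Finset.sum_nonneg fun _ _ => expNorm_nonneg _ _))

/-- Expected maximum of the norms of finitely many Gaussian vectors. -/
theorem lintegral_noiseMaj_le {ι J 𝒯 : Type*} [Fintype ι] [Fintype J] [Fintype 𝒯]
    {idx : 𝒯 → J → ι} (hidx : ∀ τ, Function.Injective (idx τ)) (c : 𝒯 → J → ℝ) {w q : ℝ}
    (hw : 0 < w) (hq : 1 ≤ q) (hc : ∀ τ, ∑ α, c τ α ^ 2 ≤ w ^ 2)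
    (hcard : (Fintype.card 𝒯 : ℝ) ≤ Real.exp (q ^ 2)) :
    ∫⁻ e, ENNReal.ofReal (noiseMaj w q fun τ => linComb (idx τ) (c τ) e)
        ∂(Measure.pi fun _ : ι => stdGaussian (Space D)) ≤ ENNReal.ofReal (4 * D * (w * q)) := by
  have hq0 : 0 < q := by linarith
  set t := q / w with ht
  have ht0 : 0 < t := div_pos hq0 hw
  have hm : ∀ τ, Measurable fun e : ι → Space D => expNorm t (linComb (idx τ) (c τ) e) := by
    intro τ
    refine (measurable_expNorm t).comp ?_
    unfold linComb; fun_prop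
  have e1 : ∀ e : ι → Space D, ENNReal.ofReal (noiseMaj w q fun τ => linComb (idx τ) (c τ) e)
      = ENNReal.ofReal (D * (2 * q * w)) + ENNReal.ofReal (t⁻¹ * Real.exp (-(t * (2 * q * w))))
        * ∑ τ, ENNReal.ofReal (expNorm t (linComb (idx τ) (c τ) e)) := by
    intro e
    have hs : 0 ≤ ∑ τ, expNorm t (linComb (idx τ) (c τ) e) :=
      Finset.sum_nonneg fun _ _ => expNorm_nonneg _ _
    unfold noiseMaj
    rw [← ht, ENNReal.ofReal_add (by positivity) (by positivity),
      ENNReal.ofReal_mul (by positivity), ENNReal.ofReal_mul (p := t⁻¹ * _) (by positivity),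
      ENNReal.ofReal_sum_of_nonneg fun _ _ => expNorm_nonneg _ _,
      ← ENNReal.ofReal_mul (by positivity)]
  simp_rw [e1]
  rw [lintegral_add_left measurable_const, lintegral_const, measure_univ, mul_one,
    lintegral_const_mul' _ _ ENNReal.ofReal_ne_top,
    lintegral_finsetSum _ fun τ _ => (hm τ).ennreal_ofReal]
  simp_rw [lintegral_expNorm_linComb (hidx _)]
  rw [← ENNReal.ofReal_sum_of_nonneg fun _ _ => by positivity,
    ← ENNReal.ofReal_mul (by positivity), ← ENNReal.ofReal_add (by positivity) (by positivity)]
  refine ENNReal.ofReal_le_ofReal ?_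
  have h1 : ∀ τ, Real.exp (t ^ 2 / 2 * ∑ α, c τ α ^ 2) ≤ Real.exp (q ^ 2 / 2) := by
    intro τ
    refine Real.exp_le_exp.2 ?_
    calc t ^ 2 / 2 * ∑ α, c τ α ^ 2 ≤ t ^ 2 / 2 * w ^ 2 := by gcongr; exact hc τ
      _ = q ^ 2 / 2 := by rw [ht]; field_simp
  have h2 : ∑ τ, 2 * D * Real.exp (t ^ 2 / 2 * ∑ α, c τ α ^ 2)
      ≤ Real.exp (q ^ 2) * (2 * D * Real.exp (q ^ 2 / 2)) := by
    calc _ ≤ ∑ _τ : 𝒯, 2 * D * Real.exp (q ^ 2 / 2) :=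
          Finset.sum_le_sum fun τ _ => by gcongr ?_ * ?_; exact h1 τ
      _ = Fintype.card 𝒯 * (2 * D * Real.exp (q ^ 2 / 2)) := by simp
      _ ≤ _ := by gcongr
  -- The threshold contributes e^{-2q²}, which beats the cardinality e^{q²} times the moment
  -- e^{q²/2}.
  have h3 : Real.exp (-(t * (2 * q * w))) * (Real.exp (q ^ 2) * (2 * D * Real.exp (q ^ 2 / 2)))
      ≤ 2 * D := by
    have : Real.exp (-(t * (2 * q * w))) * (Real.exp (q ^ 2) * (2 * D * Real.exp (q ^ 2 / 2)))
        = 2 * D * Real.exp (-(q ^ 2 / 2)) := by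
      have e : -(q ^ 2 / 2) = -(t * (2 * q * w)) + q ^ 2 + q ^ 2 / 2 := by
        rw [ht]; field_simp; ring
      rw [e, Real.exp_add, Real.exp_add]; ring
    rw [this]
    refine mul_le_of_le_one_right (by positivity) (Real.exp_le_one_iff.2 ?_)
    have := sq_nonneg q
    linarith
  have h4 : t⁻¹ ≤ w * q := by
    rw [ht, inv_div, div_le_iff₀ hq0]
    nlinarith [mul_pos hw hq0]
  calc D * (2 * q * w) + t⁻¹ * Real.exp (-(t * (2 * q * w))) *
        ∑ τ, 2 * D * Real.exp (t ^ 2 / 2 * ∑ α, c τ α ^ 2)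
      ≤ D * (2 * q * w) + t⁻¹ * Real.exp (-(t * (2 * q * w))) *
        (Real.exp (q ^ 2) * (2 * D * Real.exp (q ^ 2 / 2))) := by gcongr
    _ = D * (2 * q * w) + t⁻¹ * (Real.exp (-(t * (2 * q * w))) *
        (Real.exp (q ^ 2) * (2 * D * Real.exp (q ^ 2 / 2)))) := by ring
    _ ≤ D * (2 * q * w) + (w * q) * (2 * D) := by gcongr
    _ = _ := by ring

/-! ### The noise part of the estimators -/

theorem flowEst_eq_linComb {N m k₁ k₂ : ℕ} (nbr : (Fin N → Space D) → Space D → Fin k₁ → Fin N)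
    (tnbr : ℝ → Fin k₂ → Fin m) (X : Fin N → Space D) (e : Fin N × Fin m → Space D)
    (z : Space D) (t : ℝ) :
    flowEst nbr tnbr X (fun i j => e (i, j)) z t
      = linComb (fun p : Fin k₁ × Fin k₂ => (nbr X z p.1, tnbr t p.2))
        (fun _ => ((k₁ : ℝ) * k₂)⁻¹) e := by
  unfold flowEst linComb
  rw [← Finset.smul_sum, Fintype.sum_prod_type]

theorem sum_flowEst_coeff {k₁ k₂ : ℕ} (h₁ : 0 < k₁) (h₂ : 0 < k₂) :
    ∑ _p : Fin k₁ × Fin k₂, (((k₁ : ℝ) * k₂)⁻¹) ^ 2 = ((k₁ : ℝ) * k₂)⁻¹ := by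
  have : (0 : ℝ) < k₁ := by exact_mod_cast h₁
  have : (0 : ℝ) < k₂ := by exact_mod_cast h₂
  simp
  field_simp

/-- The average of derivative estimates along distinct trajectories is a linear combination of
distinct observations with small coefficients. -/
theorem exists_linComb_derivEst {N m k r : ℕ} {T : ℝ} (hT : 0 < T) (hk : 0 < k) (hr : 0 < r)
    {tr : Fin r → Fin N} (htr : Function.Injective tr) {tm : Fin r → Fin m}
    (hm1 : ∀ l, k ≤ (tm l : ℕ)) (hm2 : ∀ l, (tm l : ℕ) + k < m) :
    ∃ (idx : Fin r × Finset.Icc 1 k × Bool → Fin N × Fin m)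
      (c : Fin r × Finset.Icc 1 k × Bool → ℝ), Function.Injective idx ∧
      ∑ α, c α ^ 2 ≤ (2 * m / (T * Real.sqrt (r * (k : ℝ) ^ 3))) ^ 2 ∧
      ∀ e : Fin N × Fin m → Space D,
        (r : ℝ)⁻¹ • ∑ l : Fin r, derivEst T k (fun j => e (tr l, j)) (tm l)
          = linComb idx c e := by
  have hIcc : ∀ l : Finset.Icc 1 k, 1 ≤ (l : ℕ) ∧ (l : ℕ) ≤ k := fun l => Finset.mem_Icc.1 l.2
  have hlt1 : ∀ (l : Fin r) (p : Finset.Icc 1 k), (tm l : ℕ) + p < m := fun l p => by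
    have := hm2 l; have := hIcc p; omega
  have hlt2 : ∀ (l : Fin r) (p : Finset.Icc 1 k), (tm l : ℕ) - p < m := fun l p => by
    have := hm2 l; omega
  have hmpos : 0 < m := lt_of_le_of_lt (Nat.zero_le _) (hm2 ⟨0, hr⟩)
  have hmR : (0 : ℝ) < m := by exact_mod_cast hmpos
  have hkR : (0 : ℝ) < k := by exact_mod_cast hk
  have hrR : (0 : ℝ) < r := by exact_mod_cast hr
  set a : Finset.Icc 1 k → ℝ := fun p => (r : ℝ)⁻¹ * (weight k p * (2 * p * (T / m))⁻¹) with ha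
  refine ⟨fun α => (tr α.1, if α.2.2 then ⟨tm α.1 + α.2.1, hlt1 _ _⟩
      else ⟨tm α.1 - α.2.1, hlt2 _ _⟩), fun α => if α.2.2 then a α.2.1 else -a α.2.1, ?_, ?_, ?_⟩
  · rintro ⟨l, p, s⟩ ⟨l', p', s'⟩ h
    simp only [Prod.mk.injEq] at h
    obtain rfl := htr h.1
    have h2 := congrArg Fin.val h.2
    have := hIcc p; have := hIcc p'; have := hm1 l
    -- Since p ≥ 1 and k ≤ j, the positions j + p and j - p' never coincide, and the subtraction is
    -- not truncated.
    rcases s with _ | _ <;> rcases s' with _ | _ <;>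
      simp only [if_true, Bool.false_eq_true, if_false] at h2 <;> first
      | (exfalso; omega)
      | (have : p = p' := Subtype.ext (by omega)
         rw [this])
  · have h1 : ∑ α : Fin r × Finset.Icc 1 k × Bool, (if α.2.2 then a α.2.1 else -a α.2.1) ^ 2
        = r * (2 * ∑ p, a p ^ 2) := by
      rw [Fintype.sum_prod_type]
      simp only [Fintype.sum_prod_type, Fintype.sum_bool, if_true, Bool.false_eq_true, if_false,
        neg_sq, ← two_mul, ← Finset.mul_sum, Finset.sum_const, Finset.card_univ, Fintype.card_fin,
        nsmul_eq_mul]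
      ring
    set K : ℝ := (k : ℝ) * (k + 1) * (2 * k + 1) with hK
    have hKpos : 0 < K := by positivity
    have h2 : ∀ p : Finset.Icc 1 k, a p ^ 2 = (3 * m / (r * K * T)) ^ 2 * (p : ℝ) ^ 2 := by
      intro p
      have : (0 : ℝ) < p := by exact_mod_cast (hIcc p).1
      rw [ha]
      simp only [weight, ← hK]
      field_simp
      ring
    have h3 : ∑ p, a p ^ 2 = (3 * m / (r * K * T)) ^ 2 * (K / 6) := by
      simp_rw [h2]
      rw [← Finset.mul_sum, Finset.sum_coe_sort (Finset.Icc 1 k) (fun p : ℕ => (p : ℝ) ^ 2)]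
      have := sum_sq_Icc k
      congr 1
      linarith
    have h0 : (2 * m / (T * Real.sqrt (r * (k : ℝ) ^ 3))) ^ 2
        = 2 ^ 2 * (m : ℝ) ^ 2 / (T ^ 2 * (r * k ^ 3)) := by
      rw [div_pow, mul_pow, mul_pow, Real.sq_sqrt (by positivity)]
    rw [h1, h3, h0]
    have h4 : (r : ℝ) * (2 * ((3 * m / (r * K * T)) ^ 2 * (K / 6))) = 3 * m ^ 2 / (T ^ 2 * (r * K)) := by
      field_simp; norm_num
    rw [h4]
    -- The sum of squares is exactly 3m²/(T² r K); the claim follows from K ≥ k³ and 3 ≤ 4.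
    have h5 : (k : ℝ) ^ 3 ≤ K := by
      rw [hK]; nlinarith [pow_pos hkR 2, pow_pos hkR 3]
    gcongr
    norm_num
  · intro e
    unfold linComb
    rw [Fintype.sum_prod_type, Finset.smul_sum]
    refine Finset.sum_congr rfl fun l _ => ?_
    rw [Fintype.sum_prod_type]
    unfold derivEst
    rw [Finset.smul_sum, ← Finset.sum_coe_sort (Finset.Icc 1 k)]
    refine Finset.sum_congr rfl fun p _ => ?_
    rw [Fintype.sum_bool, valueAt_of_lt _ (hlt1 l p), valueAt_of_lt _ (hlt2 l p), gridTime_sub]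
    have hp := hIcc p
    have hml := hm1 l
    have h6 : (((tm l : ℕ) + p : ℕ) : ℝ) - (((tm l : ℕ) - p : ℕ) : ℝ) = 2 * p := by
      rw [Nat.cast_sub (by omega)]; push_cast; ring
    rw [h6]
    simp only [if_true, Bool.false_eq_true, if_false, ha]
    module

/-! ### Counting sample points in a ball -/

/-- `1/2` on the closed ball, `1` outside. -/
noncomputable def halfOn (R : ℝ) (z u : Space D) : ℝ := if ‖u - z‖ ≤ R then 1 / 2 else 1

/-- Exponential majorant of the indicator of `at most k points in the ball`. -/
noncomputable def fewMaj {N : ℕ} (k : ℕ) (R : ℝ) (X : Fin N → Space D) (z : Space D) : ℝ :=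
  2 ^ k * ∏ i, halfOn R z (X i)

theorem halfOn_pos (R : ℝ) (z u : Space D) : 0 < halfOn R z u := by
  unfold halfOn; split_ifs <;> norm_num

theorem fewMaj_nonneg {N : ℕ} (k : ℕ) (R : ℝ) (X : Fin N → Space D) (z : Space D) :
    0 ≤ fewMaj k R X z :=
  mul_nonneg (by positivity) (Finset.prod_nonneg fun _ _ => (halfOn_pos _ _ _).le)

theorem measurable_halfOn {α : Type*} [MeasurableSpace α] (R : ℝ) {g h : α → Space D}
    (hg : Measurable g) (hh : Measurable h) : Measurable fun x => halfOn R (g x) (h x) := by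
  unfold halfOn
  exact Measurable.ite (measurableSet_le (hh.sub hg).norm measurable_const) measurable_const
    measurable_const

theorem measurable_fewMaj {α : Type*} [MeasurableSpace α] {N : ℕ} (k : ℕ) (R : ℝ)
    {g : α → Fin N → Space D} {h : α → Space D} (hg : Measurable g)
    (hh : Measurable h) : Measurable fun x => fewMaj k R (g x) (h x) := by
  unfold fewMaj
  exact measurable_const.mul (Finset.measurable_prod _ fun i _ =>
    measurable_halfOn R hh ((measurable_pi_apply i).comp hg))

/-- With s points in the ball the majorant equals 2^k / 2^s, which is at least 1 when s < k. -/
theorem le_card_of_fewMaj_lt_one {N k : ℕ} {R : ℝ} {X : Fin N → Space D} {z : Space D}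
    (h : fewMaj k R X z < 1) : k ≤ (Finset.univ.filter fun i => ‖X i - z‖ ≤ R).card := by
  by_contra hlt
  push Not at hlt
  refine absurd h (not_lt.2 ?_)
  unfold fewMaj halfOn
  rw [Finset.prod_ite, Finset.prod_const_one, mul_one, Finset.prod_const, one_div, inv_pow,
    ← div_eq_mul_inv, one_le_div (by positivity)]
  exact pow_le_pow_right₀ (by norm_num) hlt.le

/-- The integral is 1 - μ(ball)/2 ≤ 1 - p/2 ≤ e^{-p/2}. -/
theorem lintegral_halfOn_le {μ : Measure (Space D)} [IsProbabilityMeasure μ] {R p : ℝ}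
    {z : Space D} (hp : ENNReal.ofReal p ≤ μ (Metric.closedBall z R)) :
    ∫⁻ u, ENNReal.ofReal (halfOn R z u) ∂μ ≤ ENNReal.ofReal (Real.exp (-(p / 2))) := by
  have hmeas : Measurable fun u => halfOn R z u :=
    measurable_halfOn R measurable_const measurable_id
  have hint : Integrable (fun u => halfOn R z u) μ := by
    refine Integrable.of_bound hmeas.aestronglyMeasurable 1 (Filter.Eventually.of_forall fun u => ?_)
    rw [Real.norm_of_nonneg (halfOn_pos _ _ _).le]
    unfold halfOn; split_ifs <;> norm_num
  rw [← ofReal_integral_eq_lintegral_ofReal hint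
    (Filter.Eventually.of_forall fun _ => (halfOn_pos _ _ _).le)]
  refine ENNReal.ofReal_le_ofReal ?_
  have he : (fun u => halfOn R z u)
      = fun u => 1 - (Metric.closedBall z R).indicator (fun _ => (1 / 2 : ℝ)) u := by
    funext u
    simp only [halfOn, indicator, Metric.mem_closedBall, dist_eq_norm]
    split_ifs <;> norm_num
  rw [he, integral_sub (integrable_const _)
    ((integrable_const _).indicator Metric.isClosed_closedBall.measurableSet),
    integral_indicator Metric.isClosed_closedBall.measurableSet]
  have hp' : p ≤ μ.real (Metric.closedBall z R) :=
    (ENNReal.ofReal_le_iff_le_toReal (measure_ne_top _ _)).1 hp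
  have := Real.add_one_le_exp (-(p / 2))
  simp
  linarith

/-- Chernoff bound: the factors are independent, and 2^k ≤ e^k. -/
theorem lintegral_fewMaj_le {N : ℕ} {μ : Measure (Space D)} [IsProbabilityMeasure μ] (k : ℕ)
    {R p : ℝ} {z : Space D} (hp : ENNReal.ofReal p ≤ μ (Metric.closedBall z R)) :
    ∫⁻ X : Fin N → Space D, ENNReal.ofReal (fewMaj k R X z) ∂(Measure.pi fun _ => μ)
      ≤ ENNReal.ofReal (Real.exp (k - N * (p / 2))) := by
  have hm : Measurable fun u : Space D => ENNReal.ofReal (halfOn R z u) :=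
    (measurable_halfOn R measurable_const measurable_id).ennreal_ofReal
  have e : ∀ X : Fin N → Space D, ENNReal.ofReal (fewMaj k R X z)
      = ENNReal.ofReal (2 ^ k) * ∏ i, ENNReal.ofReal (halfOn R z (X i)) := by
    intro X
    unfold fewMaj
    rw [ENNReal.ofReal_mul (by positivity),
      ENNReal.ofReal_prod_of_nonneg fun _ _ => (halfOn_pos _ _ _).le]
  simp_rw [e]
  rw [lintegral_const_mul' _ _ ENNReal.ofReal_ne_top,
    lintegral_prod_comp_coord μ (idx := fun i : Fin N => i) (fun _ _ h => h) (fun _ => hm)]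
  calc _ ≤ ENNReal.ofReal (2 ^ k) * ∏ _i : Fin N, ENNReal.ofReal (Real.exp (-(p / 2))) := by
        gcongr; exact lintegral_halfOn_le hp
    _ = ENNReal.ofReal (2 ^ k * Real.exp (-(p / 2)) ^ N) := by
        rw [Finset.prod_const, Finset.card_univ, Fintype.card_fin,
          ← ENNReal.ofReal_pow (Real.exp_pos _).le, ← ENNReal.ofReal_mul (by positivity)]
    _ ≤ _ := by
        refine ENNReal.ofReal_le_ofReal ?_
        rw [sub_eq_add_neg, Real.exp_add, ← Real.exp_nat_mul]
        have h2 : (2 : ℝ) ^ k ≤ Real.exp k := by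
          rw [← mul_one (k : ℝ), Real.exp_nat_mul]
          gcongr
          have := Real.add_one_le_exp 1
          linarith
        rw [mul_neg]
        gcongr

end FlowRegression

namespace FlowRegression

variable {D : ℕ} {L M : NNReal} {f : Space D → Space D}

/-! ### The error of the flow estimator -/

theorem flowEst_add_smul {N m k₁ k₂ : ℕ} (nbr : (Fin N → Space D) → Space D → Fin k₁ → Fin N)
    (tnbr : ℝ → Fin k₂ → Fin m) (X : Fin N → Space D) (y e : Fin N → Fin m → Space D) (σ : ℝ)
    (z : Space D) (t : ℝ) :
    flowEst nbr tnbr X (fun i j => y i j + σ • e i j) z t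
      = flowEst nbr tnbr X y z t + σ • flowEst nbr tnbr X e z t := by
  unfold flowEst
  simp only [Finset.sum_add_distrib, ← Finset.smul_sum]
  module

theorem norm_flowEst_sub_le_of_forall {N m k₁ k₂ : ℕ} (h₁ : 0 < k₁) (h₂ : 0 < k₂)
    (nbr : (Fin N → Space D) → Space D → Fin k₁ → Fin N) (tnbr : ℝ → Fin k₂ → Fin m)
    (X : Fin N → Space D) (y : Fin N → Fin m → Space D) (z : Space D) (t : ℝ) (v : Space D) {δ : ℝ}
    (h : ∀ p q, ‖y (nbr X z p) (tnbr t q) - v‖ ≤ δ) :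
    ‖flowEst nbr tnbr X y z t - v‖ ≤ δ := by
  have h1 : (0 : ℝ) < k₁ := by exact_mod_cast h₁
  have h2 : (0 : ℝ) < k₂ := by exact_mod_cast h₂
  have e : flowEst nbr tnbr X y z t - v
      = ((k₁ : ℝ) * k₂)⁻¹ • ∑ p : Fin k₁, ∑ q : Fin k₂, (y (nbr X z p) (tnbr t q) - v) := by
    unfold flowEst
    simp only [Finset.sum_sub_distrib, Finset.sum_const, Finset.card_univ, Fintype.card_fin,
      smul_sub]
    congr 1
    rw [← Nat.cast_smul_eq_nsmul ℝ, ← Nat.cast_smul_eq_nsmul ℝ, smul_smul, smul_smul,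
      show ((k₁ : ℝ) * k₂)⁻¹ * k₁ * k₂ = 1 by field_simp, one_smul]
  rw [e, norm_smul, norm_inv, Real.norm_of_nonneg (by positivity), inv_mul_le_iff₀ (by positivity)]
  calc _ ≤ ∑ _p : Fin k₁, ∑ _q : Fin k₂, δ :=
        norm_sum_le_of_le _ fun p _ => norm_sum_le_of_le _ fun q _ => h p q
    _ = _ := by simp [mul_assoc]

/-- Bias and noise of the flow estimator at a grid time. -/
theorem norm_flowEst_observations_sub_le (hf : f ∈ LipClass D L M) {T σ : ℝ} (hT : 0 < T)
    (hσ : 0 < σ) {N m k₁ k₂ : ℕ} (h₁ : 0 < k₁) (h₂ : 0 < k₂)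
    (nbr : (Fin N → Space D) → Space D → Fin k₁ → Fin N) (tnbr : ℝ → Fin k₂ → Fin m)
    (X : Fin N → Space D) (e : Fin N → Fin m → Space D) (z : Space D) (j : Fin m) {R : ℝ}
    (hX : ∀ p, ‖X (nbr X z p) - z‖ ≤ R)
    (ht : IsSuccessiveArgmin (fun i : Fin m => |gridTime T m i - gridTime T m j|)
      (tnbr (gridTime T m j))) :
    ‖flowEst nbr tnbr X (observations f T σ X e) z (gridTime T m j) - flow f z (gridTime T m j)‖
      ≤ Real.exp (L * T) * R + M * (k₂ * (T / m))
        + σ * ‖flowEst nbr tnbr X e z (gridTime T m j)‖ := by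
  unfold observations
  rw [flowEst_add_smul, add_sub_right_comm]
  refine (norm_add_le _ _).trans ?_
  rw [norm_smul, Real.norm_of_nonneg hσ.le]
  gcongr
  refine norm_flowEst_sub_le_of_forall h₁ h₂ _ _ _ _ _ _ _ fun p q => ?_
  set i := nbr X z p
  set s := tnbr (gridTime T m j) q with hs
  have h3 := norm_flow_sub_flow_le hf (X i) z (gridTime_nonneg hT m s) (gridTime_le hT s.2)
  have h4 := norm_flow_time_sub_le hf z (gridTime_nonneg hT m j) (gridTime_nonneg hT m s)
  have h5 := abs_gridTime_sub_le_of_selection hT j ht q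
  have h6 : ‖flow f (X i) (gridTime T m s) - flow f z (gridTime T m s)‖ ≤ Real.exp (L * T) * R :=
    h3.trans (by gcongr; exact hX p)
  have h7 : ‖flow f z (gridTime T m s) - flow f z (gridTime T m j)‖ ≤ M * (k₂ * (T / m)) :=
    h4.trans (by gcongr)
  exact (norm_sub_le_norm_sub_add_norm_sub _ _ _).trans (add_le_add h6 h7)

theorem trajDist_le {m k : ℕ} (g : Fin m → Space D) (x : Space D) {j : Fin m}
    (hj : j ∈ innerGrid m k) : trajDist k g x ≤ ‖g j - x‖ :=
  ciInf_le (f := fun j : innerGrid m k => ‖g j - x‖)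
    ⟨0, by rintro _ ⟨i, rfl⟩; exact norm_nonneg _⟩ ⟨j, hj⟩

theorem mem_innerGrid {m k : ℕ} {j : Fin m} :
    j ∈ innerGrid m k ↔ k ≤ (j : ℕ) ∧ (j : ℕ) + k + 2 ≤ m := by
  simp [innerGrid]
  omega

variable {n m k₁ k₂ k r : ℕ} {T : ℝ}

/-! ### The estimator as a function of the two halves of the data -/

section

variable (S : Selection D n m k₁ k₂ k r T) (f) (σ : ℝ) (x : Space D)
  (X : Fin (n / 2) → Space D) (Z : Fin (n - n / 2) → Space D)
  (e : Fin (n / 2) × Fin m → Space D) (e' : Fin (n - n / 2) × Fin m → Space D)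

/-- The observations of the first half of the sample. -/
noncomputable def fstObs (T : ℝ) : Fin (n / 2) → Fin m → Space D :=
  observations f T σ X fun i j => e (i, j)

/-- The selected trajectories. -/
noncomputable def selTraj : Fin r → Fin (n - n / 2) := S.traj X (fstObs f σ X e T) Z x

/-- The selected times. -/
noncomputable def selTime : Fin r → Fin m := S.time X (fstObs f σ X e T) Z x

/-- The estimator in terms of the initial values and noises of the two halves. -/
noncomputable def splitEst : Space D :=
  (r : ℝ)⁻¹ • ∑ l, derivEst T k
    (observations f T σ Z (fun i j => e' (i, j)) (selTraj f S σ x X Z e l))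
    (selTime f S σ x X Z e l)

/-- The noise in the averaged derivative estimates. -/
noncomputable def derivNoise : Space D :=
  (r : ℝ)⁻¹ • ∑ l, derivEst T k (fun j => e' (selTraj f S σ x X Z e l, j))
    (selTime f S σ x X Z e l)

/-- The noise in the flow estimates along the trajectories of the second half. -/
noncomputable def flowNoise (p : Fin (n - n / 2) × Fin m) : Space D :=
  flowEst S.nbr S.tnbr X (fun i j => e (i, j)) (Z p.1) (gridTime T m p.2)

end

/-- Bound on the position error of the selected points, when there are enough sample points near
the relevant initial values. -/
theorem norm_flow_selected_sub_le (S : Selection D n m k₁ k₂ k r T) (hf : f ∈ LipClass D L M)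
    (hT : 0 < T) {σ : ℝ} (hσ : 0 < σ) (h₁ : 0 < k₁) (h₂ : 0 < k₂) {x₀ : Space D} {t₀ : ℝ}
    (ht₀ : t₀ ∈ Icc 0 T) (X : Fin (n / 2) → Space D) (Z : Fin (n - n / 2) → Space D)
    (e : Fin (n / 2) × Fin m → Space D) {R G : ℝ}
    (hZ : fewMaj r R Z x₀ < 1) (hX : ∀ i, fewMaj k₁ R X (Z i) < 1)
    (hG : ∀ p, ‖flowNoise S X Z e p‖ ≤ G) (l : Fin r) :
    ‖flow f (Z (selTraj f S σ (flow f x₀ t₀) X Z e l))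
        (gridTime T m (selTime f S σ (flow f x₀ t₀) X Z e l)) - flow f x₀ t₀‖
      ≤ (Real.exp (L * T) * R + M * ((k + 2) * (T / m)))
        + 2 * (Real.exp (L * T) * R + M * (k₂ * (T / m)) + σ * G) := by
  set x := flow f x₀ t₀
  set Y := fstObs f σ X e T with hY
  set δ := Real.exp (L * T) * R + M * (k₂ * (T / m)) + σ * G with hδ
  set ρ := Real.exp (L * T) * R + M * ((k + 2) * (T / m)) with hρ
  have hest : ∀ i (j : Fin m), ‖flowEst S.nbr S.tnbr X Y (Z i) (gridTime T m j)
      - flow f (Z i) (gridTime T m j)‖ ≤ δ := by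
    intro i j
    refine (norm_flowEst_observations_sub_le hf hT hσ h₁ h₂ S.nbr S.tnbr X _ (Z i) j (R := R)
      (fun p => (S.nbr_spec X (Z i)).le_of_card (le_card_of_fewMaj_lt_one (hX i)) (fun a ha => ?_) p)
      (S.tnbr_spec _)).trans ?_
    · simpa using ha
    · rw [hδ]
      gcongr
      exact hG (i, j)
  have hmk : 2 * k + 2 ≤ m := by
    have := mem_innerGrid.1 (S.time_mem X Y Z x l)
    omega
  -- The inner grid may miss t₀; the time j₀ serves as a competitor on every trajectory that starts
  -- near x₀.
  obtain ⟨j₀, hj₀, hj₀t⟩ := exists_innerGrid_near hT hmk ht₀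
  have hdist : ∀ i, ‖Z i - x₀‖ ≤ R → trajDist k
      (fun j : Fin m => flowEst S.nbr S.tnbr X Y (Z i) (gridTime T m j)) x ≤ ρ + δ := by
    intro i hi
    refine (trajDist_le _ x hj₀).trans ?_
    have h3 := norm_flow_sub_flow_le hf (Z i) x₀ (gridTime_nonneg hT m j₀) (gridTime_le hT j₀.2)
    have h4 := norm_flow_time_sub_le hf x₀ ht₀.1 (gridTime_nonneg hT m j₀)
    have h6 : ‖flow f (Z i) (gridTime T m j₀) - flow f x₀ (gridTime T m j₀)‖
        ≤ Real.exp (L * T) * R := h3.trans (by gcongr)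
    have h7 : ‖flow f x₀ (gridTime T m j₀) - x‖ ≤ M * ((k + 2) * (T / m)) :=
      h4.trans (by gcongr)
    have h8 := hest i j₀
    have h9 := norm_sub_le_norm_sub_add_norm_sub
      (flowEst S.nbr S.tnbr X Y (Z i) (gridTime T m j₀)) (flow f (Z i) (gridTime T m j₀)) x
    have h10 := norm_sub_le_norm_sub_add_norm_sub
      (flow f (Z i) (gridTime T m j₀)) (flow f x₀ (gridTime T m j₀)) x
    linarith
  -- At least r trajectories start within R of x₀ and have estimated distance at most ρ + δ to x, so
  -- the r selected ones do too.
  have hsel := (S.traj_spec X Y Z x).le_of_card (le_card_of_fewMaj_lt_one hZ)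
    (fun i hi => hdist i (by simpa using hi)) l
  set i := S.traj X Y Z x l with hi
  set j := S.time X Y Z x l with hj
  have hmin : ‖flowEst S.nbr S.tnbr X Y (Z i) (gridTime T m j) - x‖ ≤ ρ + δ := by
    refine le_trans ?_ hsel
    have : Nonempty (innerGrid m k) := ⟨⟨j₀, hj₀⟩⟩
    exact le_ciInf fun a => S.time_spec X Y Z x l a a.2
  -- Returning from the estimated to the true position costs δ a second time, whence the factor 2.
  have h11 := hest i j
  rw [norm_sub_rev] at h11
  have h12 := norm_sub_le_norm_sub_add_norm_sub (flow f (Z i) (gridTime T m j))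
    (flowEst S.nbr S.tnbr X Y (Z i) (gridTime T m j)) x
  change ‖flow f (Z i) (gridTime T m j) - x‖ ≤ _
  linarith

/-- Pointwise bound on the error of the estimator. -/
theorem norm_splitEst_sub_le (S : Selection D n m k₁ k₂ k r T) (hf : f ∈ LipClass D L M)
    (hT : 0 < T) {σ : ℝ} (hσ : 0 < σ) (h₁ : 0 < k₁) (h₂ : 0 < k₂) (hk : 0 < k) (hr : 0 < r)
    {x₀ : Space D} {t₀ : ℝ} (ht₀ : t₀ ∈ Icc 0 T) (X : Fin (n / 2) → Space D)
    (Z : Fin (n - n / 2) → Space D) (e : Fin (n / 2) × Fin m → Space D)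
    (e' : Fin (n - n / 2) × Fin m → Space D) {R G : ℝ} (hR : 0 ≤ R) (hG0 : 0 ≤ G)
    (hG : ∀ p, ‖flowNoise S X Z e p‖ ≤ G) :
    ‖splitEst f S σ (flow f x₀ t₀) X Z e e' - f (flow f x₀ t₀)‖
      ≤ L * M * (k * (T / m)) + σ * ‖derivNoise f S σ (flow f x₀ t₀) X Z e e'‖
        + 2 * M * (fewMaj r R Z x₀ + ∑ i, fewMaj k₁ R X (Z i))
        + L * ((Real.exp (L * T) * R + M * ((k + 2) * (T / m)))
          + 2 * (Real.exp (L * T) * R + M * (k₂ * (T / m)) + σ * G)) := by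
  set x := flow f x₀ t₀ with hx
  set B := fewMaj r R Z x₀ + ∑ i, fewMaj k₁ R X (Z i) with hB
  set Δ := (Real.exp (L * T) * R + M * ((k + 2) * (T / m)))
          + 2 * (Real.exp (L * T) * R + M * (k₂ * (T / m)) + σ * G) with hΔ
  have hΔ0 : 0 ≤ Δ := by positivity
  have hsum0 : 0 ≤ ∑ i, fewMaj k₁ R X (Z i) := Finset.sum_nonneg fun _ _ => fewMaj_nonneg _ _ _ _
  have hB0 : 0 ≤ B := add_nonneg (fewMaj_nonneg _ _ _ _) hsum0
  have hrR : (0 : ℝ) < r := by exact_mod_cast hr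
  set tr := selTraj f S σ x X Z e with htr
  set tm := selTime f S σ x X Z e with htm
  have hbias : ∀ l, ‖f (flow f (Z (tr l)) (gridTime T m (tm l))) - f x‖ ≤ 2 * M * B + L * Δ := by
    intro l
    -- If B ≥ 1 the trivial bound 2M is at most 2MB; if B < 1 every count is large enough. The sum
    -- 2MB + LΔ covers both cases.
    by_cases hB1 : 1 ≤ B
    · calc _ ≤ ‖f (flow f (Z (tr l)) (gridTime T m (tm l)))‖ + ‖f x‖ := norm_sub_le _ _
        _ ≤ M + M := add_le_add (hf.2 _) (hf.2 _)
        _ = 2 * M * 1 + L * 0 := by ring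
        _ ≤ _ := by gcongr
    · push Not at hB1
      have hZ : fewMaj r R Z x₀ < 1 := by linarith
      have hX : ∀ i, fewMaj k₁ R X (Z i) < 1 := fun i => by
        have := Finset.single_le_sum (f := fun i => fewMaj k₁ R X (Z i))
          (fun _ _ => fewMaj_nonneg _ _ _ _) (Finset.mem_univ i)
        have h0 := fewMaj_nonneg r R Z x₀
        exact lt_of_le_of_lt this (by linarith)
      calc _ ≤ (L : ℝ) * ‖flow f (Z (tr l)) (gridTime T m (tm l)) - x‖ := hf.1.norm_sub_le _ _
        _ ≤ 0 + L * Δ := by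
          rw [zero_add]
          gcongr
          exact norm_flow_selected_sub_le S hf hT hσ h₁ h₂ ht₀ X Z e hZ hX hG l
        _ ≤ _ := by gcongr; positivity
  have hder : ∀ l, ‖derivEst T k (fun i : Fin m => flow f (Z (tr l)) (gridTime T m i)) (tm l)
      - f x‖ ≤ L * M * (k * (T / m)) + (2 * M * B + L * Δ) := by
    intro l
    have hml : tm l ∈ innerGrid m k := S.time_mem X (fstObs f σ X e T) Z x l
    have := mem_innerGrid.1 hml
    exact (norm_sub_le_norm_sub_add_norm_sub _ _ _).trans (add_le_add
      (norm_derivEst_flow_sub_le hf hT hk (Z (tr l)) this.1 (by omega)) (hbias l))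
  have hdecomp : splitEst f S σ x X Z e e' - f x
      = (r : ℝ)⁻¹ • ∑ l, (derivEst T k (fun i : Fin m => flow f (Z (tr l)) (gridTime T m i)) (tm l)
        - f x) + σ • derivNoise f S σ x X Z e e' := by
    unfold splitEst derivNoise observations
    simp only [← htr, ← htm, derivEst_add_smul, Finset.sum_add_distrib, Finset.sum_sub_distrib,
      ← Finset.smul_sum, Finset.sum_const, Finset.card_univ, Fintype.card_fin]
    rw [smul_add, smul_sub, ← Nat.cast_smul_eq_nsmul ℝ, smul_smul _ (r : ℝ),
      inv_mul_cancel₀ hrR.ne', one_smul, smul_comm σ]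
    abel
  rw [hdecomp]
  refine (norm_add_le _ _).trans ?_
  have h1 : ‖(r : ℝ)⁻¹ • ∑ l, (derivEst T k
      (fun i : Fin m => flow f (Z (tr l)) (gridTime T m i)) (tm l) - f x)‖
      ≤ L * M * (k * (T / m)) + (2 * M * B + L * Δ) := by
    rw [norm_smul, norm_inv, Real.norm_of_nonneg hrR.le, inv_mul_le_iff₀ hrR]
    calc _ ≤ ∑ _l : Fin r, (L * M * (k * (T / m)) + (2 * M * B + L * Δ)) :=
          norm_sum_le_of_le _ fun l _ => hder l
      _ = _ := by simp; ring
  rw [norm_smul σ, Real.norm_of_nonneg hσ.le]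
  linarith

end FlowRegression

namespace FlowRegression

/-! ### Measurability -/

/-- A measurable index in a countable set chooses among measurable functions; this handles the
data-dependent neighbours, trajectories and times. -/
theorem measurable_apply_of_finite {α ι β : Type*} [MeasurableSpace α] [MeasurableSpace ι]
    [MeasurableSingletonClass ι] [Countable ι] [MeasurableSpace β] {F : ι → α → β} {g : α → ι}
    (hF : ∀ i, Measurable (F i)) (hg : Measurable g) : Measurable fun x => F (g x) x :=
  (measurable_from_prod_countable_right (f := fun p : ι × α => F p.1 p.2) hF).comp
    (hg.prodMk measurable_id)

variable {D : ℕ} {L M : NNReal} {f : Space D → Space D} {n m k₁ k₂ k r : ℕ} {T : ℝ}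
  {α : Type*} [MeasurableSpace α]

theorem measurable_fstObs (hf : f ∈ LipClass D L M) (hT : 0 < T) (σ : ℝ)
    {X : α → Fin (n / 2) → Space D} {e : α → Fin (n / 2) × Fin m → Space D} (hX : Measurable X)
    (he : Measurable e) : Measurable fun a => fstObs f σ (X a) (e a) T := by
  unfold fstObs observations
  refine measurable_pi_lambda _ fun i => measurable_pi_lambda _ fun j => ?_
  exact ((continuous_flow hf (gridTime_nonneg hT m j)).measurable.comp
    ((measurable_pi_apply i).comp hX)).add (((measurable_pi_apply (i, j)).comp he).const_smul σ)

theorem measurable_selTraj (S : Selection D n m k₁ k₂ k r T) (hf : f ∈ LipClass D L M)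
    (hT : 0 < T) (σ : ℝ) (x : Space D) {X : α → Fin (n / 2) → Space D}
    {Z : α → Fin (n - n / 2) → Space D} {e : α → Fin (n / 2) × Fin m → Space D}
    (hX : Measurable X) (hZ : Measurable Z) (he : Measurable e) (l : Fin r) :
    Measurable fun a => selTraj f S σ x (X a) (Z a) (e a) l :=
  (measurable_pi_apply l).comp
    ((S.traj_meas x).comp (hX.prodMk ((measurable_fstObs hf hT σ hX he).prodMk hZ)))

theorem measurable_selTime (S : Selection D n m k₁ k₂ k r T) (hf : f ∈ LipClass D L M)
    (hT : 0 < T) (σ : ℝ) (x : Space D) {X : α → Fin (n / 2) → Space D}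
    {Z : α → Fin (n - n / 2) → Space D} {e : α → Fin (n / 2) × Fin m → Space D}
    (hX : Measurable X) (hZ : Measurable Z) (he : Measurable e) (l : Fin r) :
    Measurable fun a => selTime f S σ x (X a) (Z a) (e a) l :=
  (measurable_pi_apply l).comp
    ((S.time_meas x).comp (hX.prodMk ((measurable_fstObs hf hT σ hX he).prodMk hZ)))

theorem measurable_derivEst (T : ℝ) (k j : ℕ) {y : α → Fin m → Space D}
    (hy : ∀ i, Measurable fun a => y a i) : Measurable fun a => derivEst T k (y a) j := by
  have hv : ∀ i, Measurable fun a => valueAt (y a) i := by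
    intro i
    unfold valueAt
    split_ifs with h
    · exact hy _
    · exact measurable_const
  unfold derivEst
  fun_prop

theorem measurable_derivEst_selected (S : Selection D n m k₁ k₂ k r T) (hf : f ∈ LipClass D L M)
    (hT : 0 < T) (σ : ℝ) (x : Space D) {X : α → Fin (n / 2) → Space D}
    {Z : α → Fin (n - n / 2) → Space D} {e : α → Fin (n / 2) × Fin m → Space D}
    (hX : Measurable X) (hZ : Measurable Z) (he : Measurable e)
    {y : Fin (n - n / 2) → α → Fin m → Space D} (hy : ∀ i j, Measurable fun a => y i a j) :
    Measurable fun a => (r : ℝ)⁻¹ • ∑ l, derivEst T k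
      (y (selTraj f S σ x (X a) (Z a) (e a) l) a) (selTime f S σ x (X a) (Z a) (e a) l) := by
  suffices h : ∀ l, Measurable fun a => derivEst T k
      (y (selTraj f S σ x (X a) (Z a) (e a) l) a) (selTime f S σ x (X a) (Z a) (e a) l) by
    fun_prop
  intro l
  exact measurable_apply_of_finite (F := fun i a => derivEst T k
      (y i a) (selTime f S σ x (X a) (Z a) (e a) l))
    (fun i => measurable_apply_of_finite (F := fun (j : Fin m) a => derivEst T k (y i a) j)
      (fun j => measurable_derivEst T k j (hy i)) (measurable_selTime S hf hT σ x hX hZ he l))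
    (measurable_selTraj S hf hT σ x hX hZ he l)

theorem measurable_derivNoise (S : Selection D n m k₁ k₂ k r T) (hf : f ∈ LipClass D L M)
    (hT : 0 < T) (σ : ℝ) (x : Space D) {X : α → Fin (n / 2) → Space D}
    {Z : α → Fin (n - n / 2) → Space D} {e : α → Fin (n / 2) × Fin m → Space D}
    {e' : α → Fin (n - n / 2) × Fin m → Space D}
    (hX : Measurable X) (hZ : Measurable Z) (he : Measurable e) (he' : Measurable e') :
    Measurable fun a => derivNoise f S σ x (X a) (Z a) (e a) (e' a) :=
  measurable_derivEst_selected S hf hT σ x hX hZ he (y := fun i a j => e' a (i, j))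
    fun i j => (measurable_pi_apply (i, j)).comp he'

theorem measurable_splitEst (S : Selection D n m k₁ k₂ k r T) (hf : f ∈ LipClass D L M)
    (hT : 0 < T) (σ : ℝ) (x : Space D) {X : α → Fin (n / 2) → Space D}
    {Z : α → Fin (n - n / 2) → Space D} {e : α → Fin (n / 2) × Fin m → Space D}
    {e' : α → Fin (n - n / 2) × Fin m → Space D}
    (hX : Measurable X) (hZ : Measurable Z) (he : Measurable e) (he' : Measurable e') :
    Measurable fun a => splitEst f S σ x (X a) (Z a) (e a) (e' a) :=
  measurable_derivEst_selected S hf hT σ x hX hZ he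
    (y := fun i a => observations f T σ (Z a) (fun i j => e' a (i, j)) i)
    fun i j => ((continuous_flow hf (gridTime_nonneg hT m j)).measurable.comp
      ((measurable_pi_apply i).comp hZ)).add (((measurable_pi_apply (i, j)).comp he').const_smul σ)

theorem measurable_flowNoise (S : Selection D n m k₁ k₂ k r T)
    {X : α → Fin (n / 2) → Space D} {Z : α → Fin (n - n / 2) → Space D}
    {e : α → Fin (n / 2) × Fin m → Space D} (hX : Measurable X) (hZ : Measurable Z)
    (he : Measurable e) (p : Fin (n - n / 2) × Fin m) :
    Measurable fun a => flowNoise S (X a) (Z a) (e a) p := by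
  unfold flowNoise flowEst
  suffices h : ∀ q s, Measurable fun a =>
      e a (S.nbr (X a) (Z a p.1) q, S.tnbr (gridTime T m p.2) s) by
    have h' : Measurable fun a => ∑ q, ∑ s,
        e a (S.nbr (X a) (Z a p.1) q, S.tnbr (gridTime T m p.2) s) :=
      Finset.measurable_fun_sum _ fun q _ => Finset.measurable_fun_sum _ fun s _ => h q s
    exact h'.const_smul (((k₁ : ℝ) * k₂)⁻¹)
  intro q s
  have h : Measurable fun a => S.nbr (X a) (Z a p.1) q :=
    (measurable_pi_apply q).comp (S.nbr_meas.comp (hX.prodMk ((measurable_pi_apply p.1).comp hZ)))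
  exact measurable_apply_of_finite (F := fun i a => e a (i, S.tnbr (gridTime T m p.2) s))
    (fun i => (measurable_pi_apply _).comp he) h

theorem measurable_noiseMaj {𝒯 : Type*} [Fintype 𝒯] (w q : ℝ) {V : α → 𝒯 → Space D}
    (hV : ∀ τ, Measurable fun a => V a τ) : Measurable fun a => noiseMaj w q (V a) := by
  unfold noiseMaj
  exact measurable_const.add (measurable_const.mul
    (Finset.measurable_sum _ fun τ _ => (measurable_expNorm _).comp (hV τ)))

end FlowRegression

namespace FlowRegression

variable {D : ℕ} {L M : NNReal} {f : Space D → Space D} {n m k₁ k₂ k r : ℕ} {T : ℝ}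

/-! ### The expected error -/

/-- The initial values and noises of the two halves of the sample. -/
abbrev SplitData (D n m : ℕ) : Type :=
  ((Fin (n / 2) → Space D) × (Fin (n - n / 2) → Space D)) ×
    ((Fin (n / 2) × Fin m → Space D) × (Fin (n - n / 2) × Fin m → Space D))

/-- The law of the initial values and noises of the two halves of the sample. -/
noncomputable def splitLaw (n m : ℕ) (μ : Measure (Space D)) :
    Measure (SplitData D n m) :=
  ((Measure.pi fun _ => μ).prod (Measure.pi fun _ => μ)).prod
    ((Measure.pi fun _ => stdGaussian (Space D)).prod (Measure.pi fun _ => stdGaussian (Space D)))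

/-- The halves use disjoint indices, so the four blocks are independent and expectations can be
computed by Fubini under an explicit product measure. -/
theorem hasLaw_splitLaw {Ω : Type*} [MeasurableSpace Ω] {P : Measure Ω} [IsProbabilityMeasure P]
    {μ : Measure (Space D)} [IsProbabilityMeasure μ] {X : Fin n → Ω → Space D}
    {ε : Fin n → Fin m → Ω → Space D} (h : IsSample P μ X ε) :
    HasLaw (fun ω => (((fun i => X (fstHalf i) ω), (fun i => X (sndHalf i) ω)),
      ((fun p : Fin (n / 2) × Fin m => ε (fstHalf p.1) p.2 ω),
        (fun p : Fin (n - n / 2) × Fin m => ε (sndHalf p.1) p.2 ω)))) (splitLaw n m μ) P := by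
  have hinj : Function.Injective (Sum.elim fstHalf sndHalf : Fin (n / 2) ⊕ Fin (n - n / 2) → Fin n) := by
    rintro (i | i) (j | j) hij <;> simp [fstHalf, sndHalf] at hij
    · exact congrArg _ (Fin.ext hij)
    · omega
    · omega
    · exact congrArg _ (Fin.ext hij)
  have hinj' : Function.Injective (Sum.elim (fun p => (fstHalf p.1, p.2)) (fun p => (sndHalf p.1, p.2)) :
      (Fin (n / 2) × Fin m) ⊕ (Fin (n - n / 2) × Fin m) → Fin n × Fin m) := by
    rintro (⟨i, a⟩ | ⟨i, a⟩) (⟨j, b⟩ | ⟨j, b⟩) hij <;> simp [fstHalf, sndHalf] at hij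
    · obtain ⟨h1, rfl⟩ := hij; rw [Fin.ext h1]
    · omega
    · omega
    · obtain ⟨h1, rfl⟩ := hij; rw [Fin.ext h1]
  have h1 := hasLaw_prodMk_pi h.law_init h.indep_init hinj
  have h2 := hasLaw_prodMk_pi (fun p : Fin n × Fin m => h.law_noise p.1 p.2) h.indep_noise hinj'
  refine IndepFun.hasLaw_prod h1 h2 ?_
  have hφ : Measurable fun X : Fin n → Space D =>
      ((fun i : Fin (n / 2) => X (fstHalf i)), (fun i : Fin (n - n / 2) => X (sndHalf i))) := by
    fun_prop
  have hψ : Measurable fun e : Fin n → Fin m → Space D =>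
      ((fun p : Fin (n / 2) × Fin m => e (fstHalf p.1) p.2),
        (fun p : Fin (n - n / 2) × Fin m => e (sndHalf p.1) p.2)) := by
    fun_prop
  exact h.indep_init_noise.comp hφ hψ

/-- Sample splitting: with X, Z and e fixed, the selected trajectories and times are constants,
while e' remains a fresh Gaussian family. The bound on the inner integral is uniform in e. -/
theorem lintegral_derivNoise_le (S : Selection D n m k₁ k₂ k r T) (hf : f ∈ LipClass D L M)
    (hT : 0 < T) (hk : 0 < k) (hr : 0 < r) (σ : ℝ) (x : Space D)
    (X : Fin (n / 2) → Space D) (Z : Fin (n - n / 2) → Space D) :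
    ∫⁻ p, ENNReal.ofReal ‖derivNoise f S σ x X Z p.1 p.2‖
        ∂((Measure.pi fun _ => stdGaussian (Space D)).prod
          (Measure.pi fun _ => stdGaussian (Space D)))
      ≤ ENNReal.ofReal (4 * D * (2 * m / (T * Real.sqrt (r * (k : ℝ) ^ 3)))) := by
  have hmeas : Measurable fun p : (Fin (n / 2) × Fin m → Space D) ×
      (Fin (n - n / 2) × Fin m → Space D) => ENNReal.ofReal ‖derivNoise f S σ x X Z p.1 p.2‖ :=
    (measurable_derivNoise S hf hT σ x measurable_const measurable_const measurable_fst
      measurable_snd).norm.ennreal_ofReal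
  rw [lintegral_prod _ hmeas.aemeasurable]
  have hin : ∀ e : Fin (n / 2) × Fin m → Space D,
      ∫⁻ e', ENNReal.ofReal ‖derivNoise f S σ x X Z e e'‖ ∂(Measure.pi fun _ => stdGaussian (Space D))
        ≤ ENNReal.ofReal (4 * D * (2 * m / (T * Real.sqrt (r * (k : ℝ) ^ 3)))) := by
    intro e
    have hinner : ∀ l, selTime f S σ x X Z e l ∈ innerGrid m k := S.time_mem X _ Z x
    obtain ⟨idx, c, hidx, hc, hlin⟩ := exists_linComb_derivEst hT hk hr
      (S.traj_spec X (fstObs f σ X e T) Z x).injective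
      (fun l => (mem_innerGrid.1 (hinner l)).1)
      (fun l => by have := (mem_innerGrid.1 (hinner l)).2; omega)
    have hm : 0 < m := lt_of_le_of_lt (Nat.zero_le _) (selTime f S σ x X Z e ⟨0, hr⟩).2
    have hmR : (0 : ℝ) < m := by exact_mod_cast hm
    have hkR : (0 : ℝ) < k := by exact_mod_cast hk
    have hrR : (0 : ℝ) < r := by exact_mod_cast hr
    have heq : ∀ e', derivNoise f S σ x X Z e e' = linComb idx c e' := fun e' => hlin e'
    simp_rw [heq]
    exact lintegral_norm_linComb_le hidx c (by positivity) hc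
  refine (lintegral_mono hin).trans ?_
  simp

/-- The neighbours do not depend on e, so at fixed initial values each entry averages k₁k₂ distinct
Gaussian vectors. Only the (n - ⌊n/2⌋)m pairs (Z_i, t_j) matter, so a finite maximum replaces a
supremum over space. -/
theorem lintegral_flowNoise_le (S : Selection D n m k₁ k₂ k r T) (h₁ : 0 < k₁) (h₂ : 0 < k₂)
    (X : Fin (n / 2) → Space D) (Z : Fin (n - n / 2) → Space D) {w q : ℝ} (hw : 0 < w)
    (hwk : ((k₁ : ℝ) * k₂)⁻¹ ≤ w ^ 2) (hq : 1 ≤ q) (hqn : (n : ℝ) * m ≤ Real.exp (q ^ 2)) :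
    ∫⁻ e, ENNReal.ofReal (noiseMaj w q (flowNoise S X Z e))
        ∂(Measure.pi fun _ => stdGaussian (Space D)) ≤ ENNReal.ofReal (4 * D * (w * q)) := by
  have heq : ∀ e : Fin (n / 2) × Fin m → Space D, flowNoise S X Z e
      = fun p => linComb (fun s : Fin k₁ × Fin k₂ =>
        (S.nbr X (Z p.1) s.1, S.tnbr (gridTime T m p.2) s.2)) (fun _ => ((k₁ : ℝ) * k₂)⁻¹) e :=
    fun e => funext fun p => flowEst_eq_linComb _ _ _ _ _ _
  simp_rw [heq]
  refine lintegral_noiseMaj_le (fun p => ?_) _ hw hq (fun _ => ?_) ?_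
  · rintro ⟨a, b⟩ ⟨a', b'⟩ h
    simp only [Prod.mk.injEq] at h
    rw [(S.nbr_spec X (Z p.1)).injective h.1, (S.tnbr_spec _).injective h.2]
  · rw [sum_flowEst_coeff h₁ h₂]
    exact hwk
  · refine le_trans ?_ hqn
    simp only [Fintype.card_prod, Fintype.card_fin, Nat.cast_mul]
    gcongr
    omega

theorem ae_mem_support_pi {N : ℕ} (μ : Measure (Space D)) [IsProbabilityMeasure μ] :
    ∀ᵐ Z ∂(Measure.pi fun _ : Fin N => μ), ∀ i, Z i ∈ μ.support := by
  rw [ae_all_iff]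
  intro i
  exact (measurePreserving_eval (fun _ : Fin N => μ) i).quasiMeasurePreserving.ae
    Measure.support_mem_ae

/-- Bound on the probability of having too few sample points near some relevant initial value. -/
theorem lintegral_fewMaj_split_le {μ : Measure (Space D)} [IsProbabilityMeasure μ]
    {x₀ : Space D} (hx₀ : x₀ ∈ μ.support) {R p : ℝ}
    (hμ : ∀ z ∈ μ.support, ENNReal.ofReal p ≤ μ (Metric.closedBall z R)) (k₁ r : ℕ) :
    ∫⁻ U : (Fin (n / 2) → Space D) × (Fin (n - n / 2) → Space D),
        ENNReal.ofReal (fewMaj r R U.2 x₀ + ∑ i, fewMaj k₁ R U.1 (U.2 i))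
        ∂((Measure.pi fun _ => μ).prod (Measure.pi fun _ => μ))
      ≤ ENNReal.ofReal (Real.exp (r - (n - n / 2 : ℕ) * (p / 2))
        + n * Real.exp (k₁ - (n / 2 : ℕ) * (p / 2))) := by
  have hm1 : Measurable fun U : (Fin (n / 2) → Space D) × (Fin (n - n / 2) → Space D) =>
      fewMaj r R U.2 x₀ :=
    measurable_fewMaj r R measurable_snd measurable_const
  have hm2 : ∀ i, Measurable fun U : (Fin (n / 2) → Space D) × (Fin (n - n / 2) → Space D) =>
      fewMaj k₁ R U.1 (U.2 i) := fun i =>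
    measurable_fewMaj k₁ R measurable_fst
      ((measurable_pi_apply i).comp measurable_snd)
  simp_rw [ENNReal.ofReal_add (fewMaj_nonneg r R _ x₀)
    (Finset.sum_nonneg fun i _ => fewMaj_nonneg k₁ R _ _),
    ENNReal.ofReal_sum_of_nonneg fun i _ => fewMaj_nonneg k₁ R _ _]
  rw [lintegral_add_left hm1.ennreal_ofReal,
    lintegral_finsetSum _ fun i _ => (hm2 i).ennreal_ofReal,
    ENNReal.ofReal_add (Real.exp_pos _).le (by positivity)]
  refine add_le_add ?_ ?_
  · rw [lintegral_prod _ hm1.ennreal_ofReal.aemeasurable]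
    refine (lintegral_mono fun X => lintegral_fewMaj_le r (hμ x₀ hx₀)).trans ?_
    simp
  · have h1 : ∀ i : Fin (n - n / 2), ∫⁻ U : (Fin (n / 2) → Space D) × (Fin (n - n / 2) → Space D),
        ENNReal.ofReal (fewMaj k₁ R U.1 (U.2 i))
          ∂((Measure.pi fun _ => μ).prod (Measure.pi fun _ => μ))
        ≤ ENNReal.ofReal (Real.exp (k₁ - (n / 2 : ℕ) * (p / 2))) := by
      intro i
      -- X is integrated first, at fixed Z; the mass bound applies around Z_i because Z_i lies in
      -- the support almost surely.
      rw [lintegral_prod_symm _ (hm2 i).ennreal_ofReal.aemeasurable]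
      refine (lintegral_mono_ae (g := fun _ =>
        ENNReal.ofReal (Real.exp (k₁ - (n / 2 : ℕ) * (p / 2)))) ?_).trans (by simp)
      filter_upwards [ae_mem_support_pi μ] with Z hZ
      exact lintegral_fewMaj_le k₁ (hμ _ (hZ i))
    refine (Finset.sum_le_sum fun i _ => h1 i).trans ?_
    rw [Finset.sum_const, Finset.card_univ, Fintype.card_fin, ← ENNReal.ofReal_nsmul]
    refine ENNReal.ofReal_le_ofReal ?_
    rw [nsmul_eq_mul]
    gcongr
    omega

/-- The expected error of the estimator, before calibration. -/
theorem lintegral_splitEst_le (S : Selection D n m k₁ k₂ k r T) (hf : f ∈ LipClass D L M)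
    (hT : 0 < T) {σ : ℝ} (hσ : 0 < σ) (h₁ : 0 < k₁) (h₂ : 0 < k₂) (hk : 0 < k) (hr : 0 < r)
    {μ : Measure (Space D)} [IsProbabilityMeasure μ] {x₀ : Space D} (hx₀ : x₀ ∈ μ.support)
    {t₀ : ℝ} (ht₀ : t₀ ∈ Icc 0 T) {R p : ℝ} (hR : 0 ≤ R)
    (hμ : ∀ z ∈ μ.support, ENNReal.ofReal p ≤ μ (Metric.closedBall z R)) {w q : ℝ} (hw : 0 < w)
    (hwk : ((k₁ : ℝ) * k₂)⁻¹ ≤ w ^ 2) (hq : 1 ≤ q) (hqn : (n : ℝ) * m ≤ Real.exp (q ^ 2)) :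
    ∫⁻ U, ENNReal.ofReal ‖splitEst f S σ (flow f x₀ t₀) U.1.1 U.1.2 U.2.1 U.2.2
        - f (flow f x₀ t₀)‖ ∂(splitLaw n m μ)
      ≤ ENNReal.ofReal (L * M * (k * (T / m))
        + L * ((Real.exp (L * T) * R + M * ((k + 2) * (T / m)))
          + 2 * (Real.exp (L * T) * R + M * (k₂ * (T / m))))
        + σ * (4 * D * (2 * m / (T * Real.sqrt (r * (k : ℝ) ^ 3))))
        + 2 * M * (Real.exp (r - (n - n / 2 : ℕ) * (p / 2))
          + n * Real.exp (k₁ - (n / 2 : ℕ) * (p / 2)))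
        + 2 * L * σ * (4 * D * (w * q))) := by
  have hq0 : 0 < q := by linarith
  set x := flow f x₀ t₀ with hx
  set A : ℝ := L * M * (k * (T / m))
        + L * ((Real.exp (L * T) * R + M * ((k + 2) * (T / m)))
          + 2 * (Real.exp (L * T) * R + M * (k₂ * (T / m)))) with hA
  have hA0 : 0 ≤ A := by positivity
  have hpoint : ∀ U : SplitData D n m,
      ENNReal.ofReal ‖splitEst f S σ x U.1.1 U.1.2 U.2.1 U.2.2 - f x‖
        ≤ ENNReal.ofReal A
          + ENNReal.ofReal σ * ENNReal.ofReal ‖derivNoise f S σ x U.1.1 U.1.2 U.2.1 U.2.2‖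
          + ENNReal.ofReal (2 * M)
            * ENNReal.ofReal (fewMaj r R U.1.2 x₀ + ∑ i, fewMaj k₁ R U.1.1 (U.1.2 i))
          + ENNReal.ofReal (2 * L * σ)
            * ENNReal.ofReal (noiseMaj w q (flowNoise S U.1.1 U.1.2 U.2.1)) := by
    intro U
    have hG0 := noiseMaj_nonneg hw hq0 (flowNoise S U.1.1 U.1.2 U.2.1)
    have hB0 : 0 ≤ fewMaj r R U.1.2 x₀ + ∑ i, fewMaj k₁ R U.1.1 (U.1.2 i) :=
      add_nonneg (fewMaj_nonneg _ _ _ _) (Finset.sum_nonneg fun _ _ => fewMaj_nonneg _ _ _ _)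
    have h := norm_splitEst_sub_le S hf hT hσ h₁ h₂ hk hr ht₀ U.1.1 U.1.2 U.2.1 U.2.2 (R := R) hR
      (x₀ := x₀) hG0 (norm_le_noiseMaj hw hq0 _)
    rw [← ENNReal.ofReal_mul hσ.le, ← ENNReal.ofReal_mul (by positivity),
      ← ENNReal.ofReal_mul (by positivity), ← ENNReal.ofReal_add hA0 (by positivity),
      ← ENNReal.ofReal_add (by positivity) (by positivity),
      ← ENNReal.ofReal_add (by positivity) (by positivity)]
    refine ENNReal.ofReal_le_ofReal (h.trans (le_of_eq ?_))
    rw [hA]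
    ring
  have hmX : Measurable fun U : SplitData D n m => U.1.1 :=
    measurable_fst.comp measurable_fst
  have hmZ : Measurable fun U : SplitData D n m => U.1.2 :=
    measurable_snd.comp measurable_fst
  have hme : Measurable fun U : SplitData D n m => U.2.1 :=
    measurable_fst.comp measurable_snd
  have hme' : Measurable fun U : SplitData D n m => U.2.2 :=
    measurable_snd.comp measurable_snd
  have hm1 := (measurable_derivNoise S hf hT σ x hmX hmZ hme hme').norm.ennreal_ofReal
  have hm2a : Measurable fun U : SplitData D n m => fewMaj r R U.1.2 x₀ :=
    measurable_fewMaj r R hmZ measurable_const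
  have hm2b : ∀ i, Measurable fun U : SplitData D n m => fewMaj k₁ R U.1.1 (U.1.2 i) := fun i =>
    measurable_fewMaj k₁ R hmX ((measurable_pi_apply i).comp hmZ)
  have hm2 : Measurable fun U : SplitData D n m =>
      ENNReal.ofReal (fewMaj r R U.1.2 x₀ + ∑ i, fewMaj k₁ R U.1.1 (U.1.2 i)) :=
    (hm2a.add (Finset.measurable_fun_sum _ fun i _ => hm2b i)).ennreal_ofReal
  have hm3 := (measurable_noiseMaj w q (measurable_flowNoise S hmX hmZ hme)).ennreal_ofReal
  have hI1 : ∫⁻ U, ENNReal.ofReal ‖derivNoise f S σ x U.1.1 U.1.2 U.2.1 U.2.2‖ ∂(splitLaw n m μ)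
      ≤ ENNReal.ofReal (4 * D * (2 * m / (T * Real.sqrt (r * (k : ℝ) ^ 3)))) := by
    unfold splitLaw
    rw [lintegral_prod _ hm1.aemeasurable]
    refine (lintegral_mono (g := fun _ =>
      ENNReal.ofReal (4 * D * (2 * m / (T * Real.sqrt (r * (k : ℝ) ^ 3))))) fun V => ?_).trans
      (by rw [lintegral_const, measure_univ, mul_one])
    exact lintegral_derivNoise_le S hf hT hk hr σ x V.1 V.2
  have hI2 : ∫⁻ U, ENNReal.ofReal (fewMaj r R U.1.2 x₀ + ∑ i, fewMaj k₁ R U.1.1 (U.1.2 i))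
        ∂(splitLaw n m μ)
      ≤ ENNReal.ofReal (Real.exp (r - (n - n / 2 : ℕ) * (p / 2))
          + n * Real.exp (k₁ - (n / 2 : ℕ) * (p / 2))) := by
    unfold splitLaw
    rw [lintegral_prod _ hm2.aemeasurable]
    simp only [lintegral_const, measure_univ, mul_one]
    exact lintegral_fewMaj_split_le hx₀ hμ k₁ r
  have hI3 : ∫⁻ U, ENNReal.ofReal (noiseMaj w q (flowNoise S U.1.1 U.1.2 U.2.1)) ∂(splitLaw n m μ)
      ≤ ENNReal.ofReal (4 * D * (w * q)) := by
    unfold splitLaw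
    rw [lintegral_prod _ hm3.aemeasurable]
    refine (lintegral_mono (g := fun _ => ENNReal.ofReal (4 * D * (w * q))) fun V => ?_).trans
      (by rw [lintegral_const, measure_univ, mul_one])
    have hmV := (measurable_noiseMaj w q (measurable_flowNoise S (α := (Fin (n / 2) × Fin m →
      Space D) × (Fin (n - n / 2) × Fin m → Space D)) (X := fun _ => V.1) (Z := fun _ => V.2)
      measurable_const measurable_const measurable_fst)).ennreal_ofReal
    simp only
    rw [lintegral_prod _ hmV.aemeasurable]
    simp only [lintegral_const, measure_univ, mul_one]
    exact lintegral_flowNoise_le S h₁ h₂ V.1 V.2 hw hwk hq hqn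
  have : IsProbabilityMeasure (splitLaw n m μ) := by unfold splitLaw; infer_instance
  clear_value A
  refine (lintegral_mono hpoint).trans ?_
  rw [lintegral_add_right _ (hm3.const_mul _), lintegral_add_right _ (hm2.const_mul _),
    lintegral_add_right _ (hm1.const_mul _), lintegral_const, measure_univ, mul_one,
    lintegral_const_mul' _ _ ENNReal.ofReal_ne_top, lintegral_const_mul' _ _ ENNReal.ofReal_ne_top,
    lintegral_const_mul' _ _ ENNReal.ofReal_ne_top]
  rw [ENNReal.ofReal_add (by positivity) (by positivity),
    ENNReal.ofReal_add (by positivity) (by positivity), ENNReal.ofReal_add hA0 (by positivity),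
    ENNReal.ofReal_mul (p := σ) hσ.le, ENNReal.ofReal_mul (p := 2 * (M : ℝ)) (by positivity),
    ENNReal.ofReal_mul (p := 2 * (L : ℝ) * σ) (by positivity)]
  gcongr

end FlowRegression

namespace FlowRegression

/-! ### Consequences of the calibration -/

/-! ### Exponent arithmetic, carried out on the logarithms of the variables. -/

section Powers

variable {b x y u v : ℝ}

theorem steps_power_eq (hb : 0 < b) (hx : 0 < x) (hy : 0 < y) :
    y ^ ((4 + b) / (5 + b)) / x ^ (1 / (5 + b)) = y * (1 / (x * y)) ^ (1 / (5 + b)) := by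
  obtain ⟨A, rfl⟩ : ∃ A, Real.exp A = x := ⟨_, Real.exp_log hx⟩
  obtain ⟨B, rfl⟩ : ∃ B, Real.exp B = y := ⟨_, Real.exp_log hy⟩
  simp only [one_div, ← Real.exp_add, ← Real.exp_sub, ← Real.exp_mul, ← Real.exp_neg]
  congr 1
  field_simp
  ring

theorem trajectories_power_eq (hb : 0 < b) (hx : 0 < x) (hy : 0 < y) :
    x ^ (5 / (5 + b)) / y ^ (b / (5 + b)) = x * ((1 / (x * y)) ^ (1 / (5 + b))) ^ b := by
  obtain ⟨A, rfl⟩ : ∃ A, Real.exp A = x := ⟨_, Real.exp_log hx⟩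
  obtain ⟨B, rfl⟩ : ∃ B, Real.exp B = y := ⟨_, Real.exp_log hy⟩
  simp only [one_div, ← Real.exp_add, ← Real.exp_sub, ← Real.exp_mul, ← Real.exp_neg]
  congr 1
  field_simp
  ring

/-- The balance behind the calibration: for the unclamped values of r and k, the noise level m/√(r
k³) is exactly (nm)^{-1/(5+b)}. -/
theorem variance_power_eq (hb : 0 < b) (hx : 0 < x) (hy : 0 < y) :
    (x ^ (5 / (5 + b)) / y ^ (b / (5 + b))) * (y ^ ((4 + b) / (5 + b)) / x ^ (1 / (5 + b))) ^ 3
      * ((1 / (x * y)) ^ (1 / (5 + b))) ^ 2 = y ^ 2 := by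
  obtain ⟨A, rfl⟩ : ∃ A, Real.exp A = x := ⟨_, Real.exp_log hx⟩
  obtain ⟨B, rfl⟩ : ∃ B, Real.exp B = y := ⟨_, Real.exp_log hy⟩
  simp only [one_div, ← Real.exp_add, ← Real.exp_sub, ← Real.exp_mul, ← Real.exp_neg,
    ← Real.exp_nat_mul]
  congr 1
  push_cast
  field_simp
  ring

/-- The right side is u times the left. With u = ln n and v = ln(nm), the calibrated k₁ is thus
below nθ^b, where θ is the rate of the flow estimator. -/
theorem neighbours_power_le (hb : 0 < b) (hx : 0 < x) (hy : 0 < y) (hu : 1 ≤ u) (hv : 0 < v) :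
    (x / u) ^ (3 / (b + 3)) / (y / v) ^ (b / (b + 3))
      ≤ x * ((u * v / (x * y)) ^ (1 / (b + 3))) ^ b := by
  obtain ⟨A, rfl⟩ : ∃ A, Real.exp A = x := ⟨_, Real.exp_log hx⟩
  obtain ⟨B, rfl⟩ : ∃ B, Real.exp B = y := ⟨_, Real.exp_log hy⟩
  obtain ⟨V, rfl⟩ : ∃ V, Real.exp V = v := ⟨_, Real.exp_log hv⟩
  obtain ⟨U, rfl⟩ : ∃ U, Real.exp U = u := ⟨_, Real.exp_log (by linarith)⟩
  have hU : 0 ≤ U := by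
    have := Real.log_nonneg hu
    rwa [Real.log_exp] at this
  simp only [one_div, ← Real.exp_add, ← Real.exp_sub, ← Real.exp_mul]
  refine Real.exp_le_exp.2 ?_
  have e : A + (U + V - (A + B)) * (b + 3)⁻¹ * b
      - ((A - U) * (3 / (b + 3)) - (B - V) * (b / (b + 3))) = U := by
    field_simp
    ring
  linarith

theorem times_power_eq (hb : 0 < b) (hx : 0 < x) (hy : 0 < y) (hu : 0 < u) (hv : 0 < v) :
    y ^ ((b + 2) / (b + 3)) / (x / (u * v)) ^ (1 / (b + 3))
      = y * (u * v / (x * y)) ^ (1 / (b + 3)) := by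
  obtain ⟨A, rfl⟩ : ∃ A, Real.exp A = x := ⟨_, Real.exp_log hx⟩
  obtain ⟨B, rfl⟩ : ∃ B, Real.exp B = y := ⟨_, Real.exp_log hy⟩
  obtain ⟨V, rfl⟩ : ∃ V, Real.exp V = v := ⟨_, Real.exp_log hv⟩
  obtain ⟨U, rfl⟩ : ∃ U, Real.exp U = u := ⟨_, Real.exp_log hu⟩
  simp only [one_div, ← Real.exp_add, ← Real.exp_sub, ← Real.exp_mul]
  congr 1
  field_simp
  ring

/-- With v = ln(nm), this says that √(ln(nm)/(k₁k₂)) equals θ for the unclamped values. -/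
theorem flow_variance_power_eq (hb : 0 < b) (hx : 0 < x) (hy : 0 < y) (hu : 0 < u) (hv : 0 < v) :
    ((x / u) ^ (3 / (b + 3)) / (y / v) ^ (b / (b + 3)))
      * (y ^ ((b + 2) / (b + 3)) / (x / (u * v)) ^ (1 / (b + 3)))
      * ((u * v / (x * y)) ^ (1 / (b + 3))) ^ 2 = v := by
  obtain ⟨A, rfl⟩ : ∃ A, Real.exp A = x := ⟨_, Real.exp_log hx⟩
  obtain ⟨B, rfl⟩ : ∃ B, Real.exp B = y := ⟨_, Real.exp_log hy⟩
  obtain ⟨V, rfl⟩ : ∃ V, Real.exp V = v := ⟨_, Real.exp_log hv⟩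
  obtain ⟨U, rfl⟩ : ∃ U, Real.exp U = u := ⟨_, Real.exp_log hu⟩
  simp only [one_div, ← Real.exp_add, ← Real.exp_sub, ← Real.exp_mul, ← Real.exp_nat_mul]
  congr 1
  push_cast
  field_simp
  ring

/-- The logarithmic factors of the flow estimator are absorbed by a better exponent. -/
theorem flow_rate_le (hb : 0 < b) (hx : 0 < x) (hu : 0 ≤ u) (huv : u ≤ Real.log x)
    (hx1 : 1 ≤ x) :
    (u * Real.log x / x) ^ (1 / (b + 3))
      ≤ (b + 5) ^ (2 / (b + 3)) * (1 / x) ^ (1 / (5 + b)) := by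
  have hl0 : 0 ≤ Real.log x := Real.log_nonneg hx1
  -- The power 1/(b+5) is tuned so that (2/(b+5) - 1)/(b+3) = -1/(b+5).
  have hl : Real.log x ≤ (b + 5) * x ^ (1 / (b + 5)) := by
    have := Real.log_le_rpow_div hx.le (by positivity : 0 < 1 / (b + 5))
    rwa [div_div_eq_mul_div, div_one, mul_comm] at this
  have h1 : u * Real.log x / x ≤ ((b + 5) * x ^ (1 / (b + 5))) ^ 2 / x := by
    rw [sq]
    gcongr
    exact huv.trans hl
  refine (Real.rpow_le_rpow (by positivity) h1 (by positivity)).trans (le_of_eq ?_)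
  have h5 : 0 < b + 5 := by linarith
  obtain ⟨A, rfl⟩ : ∃ A, Real.exp A = x := ⟨_, Real.exp_log hx⟩
  obtain ⟨Q, hQ⟩ : ∃ Q, Real.exp Q = b + 5 := ⟨_, Real.exp_log h5⟩
  rw [add_comm 5 b]
  have e1 : ((b + 5) * Real.exp A ^ (1 / (b + 5))) ^ 2 / Real.exp A
      = Real.exp (2 * (Q + A * (1 / (b + 5))) - A) := by
    rw [Real.exp_sub, ← hQ, ← Real.exp_mul, ← Real.exp_add, ← Real.exp_nat_mul]
    norm_num
  have e2 : (b + 5) ^ (2 / (b + 3)) = Real.exp (Q * (2 / (b + 3))) := by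
    rw [Real.exp_mul, hQ]
  rw [e1, e2, one_div (Real.exp A), ← Real.exp_neg, ← Real.exp_mul, ← Real.exp_mul, ← Real.exp_add]
  congr 1
  field_simp
  ring

end Powers

/-! ### Calibrated parameters measured against the rate. -/

section Rates

variable {b c c' : ℝ} {n m k₁ k₂ k r : ℕ}

theorem one_le_log_natCast (hn : 3 ≤ n) : 1 ≤ Real.log n := by
  rw [Real.le_log_iff_exp_le (by positivity)]
  have h3 : (3 : ℝ) ≤ n := by exact_mod_cast hn
  linarith [Real.exp_one_lt_d9]

theorem Comparable.pos {v : ℝ} (h : Comparable c c' k (max v 1)) (hc : 0 < c) : 0 < k := by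
  have : (0 : ℝ) < k := lt_of_lt_of_le (by positivity) h.1
  exact_mod_cast this

theorem Comparable.lower {v : ℝ} (h : Comparable c c' k (max v 1)) (hc : 0 < c) : c * v ≤ k :=
  (mul_le_mul_of_nonneg_left (le_max_left _ _) hc.le).trans h.1

theorem Comparable.upper {v w : ℝ} (h : Comparable c c' k (max v 1)) (hc' : 0 ≤ c') (hv : v ≤ w)
    (h1 : 1 ≤ w) : k ≤ c' * w :=
  h.2.trans (mul_le_mul_of_nonneg_left (max_le hv h1) hc')

theorem rate_pos (hm : 0 < m) : 0 < rate b n m :=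
  lt_of_lt_of_le (by positivity) (le_max_right _ _)

/-- This comes from the term (ln n / n)^{1/b} of the rate. It absorbs the clamping of r and k₁ at 1
and gives the deviation bounds their strength. -/
theorem log_le_rate (hb : 0 < b) (hn : 3 ≤ n) :
    Real.log n ≤ n * rate b n m ^ b := by
  have hn0 : (0 : ℝ) < n := by exact_mod_cast (by omega : 0 < n)
  have hl := one_le_log_natCast hn
  have h : (Real.log n / n) ^ (1 / b) ≤ rate b n m :=
    (le_max_right _ _).trans (le_max_left _ _)
  have h2 := Real.rpow_le_rpow (by positivity) h hb.le
  rw [← Real.rpow_mul (by positivity), one_div_mul_cancel hb.ne', Real.rpow_one,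
    div_le_iff₀ hn0] at h2
  linarith

theorem pow_le_rate : (1 / ((n : ℝ) * m)) ^ (1 / (5 + b)) ≤ rate b n m :=
  (le_max_left _ _).trans (le_max_left _ _)

theorem one_le_mul_rate (hm : 0 < m) : 1 ≤ m * rate b n m := by
  have hm0 : (0 : ℝ) < m := by exact_mod_cast hm
  have : 1 / (m : ℝ) ≤ rate b n m := le_max_right _ _
  rwa [div_le_iff₀ hm0, mul_comm] at this

theorem flow_rate_le_rate (hb : 0 < b) (hn : 3 ≤ n) (hm : 3 ≤ m) :
    (Real.log n * Real.log (n * m) / (n * m)) ^ (1 / (b + 3))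
      ≤ (b + 5) ^ (2 / (b + 3)) * rate b n m := by
  have hn1 : (3 : ℝ) ≤ n := by exact_mod_cast hn
  have hm1 : (3 : ℝ) ≤ m := by exact_mod_cast hm
  have h := flow_rate_le (b := b) (x := n * m) (u := Real.log n) hb (by positivity)
    (by linarith [one_le_log_natCast hn]) (Real.log_le_log (by positivity) (by nlinarith))
    (by nlinarith)
  exact h.trans (mul_le_mul_of_nonneg_left pow_le_rate (by positivity))

theorem Calibrated.steps_le (h : Calibrated b c c' n m k₁ k₂ k r) (hb : 0 < b) (hc' : 0 ≤ c')
    (hn : 0 < n) (hm : 0 < m) : (k : ℝ) ≤ c' * (m * rate b n m) := by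
  refine h.k_spec.upper hc' ?_ (one_le_mul_rate hm)
  rw [steps_power_eq hb (by exact_mod_cast hn) (by exact_mod_cast hm)]
  gcongr
  exact pow_le_rate

theorem Calibrated.trajectories_le (h : Calibrated b c c' n m k₁ k₂ k r) (hb : 0 < b)
    (hc' : 0 ≤ c') (hn : 3 ≤ n) (hm : 0 < m) : (r : ℝ) ≤ c' * (n * rate b n m ^ b) := by
  refine h.r_spec.upper hc' ?_ ((one_le_log_natCast hn).trans (log_le_rate hb hn))
  rw [trajectories_power_eq hb (by exact_mod_cast (by omega : 0 < n)) (by exact_mod_cast hm)]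
  gcongr
  exact pow_le_rate

theorem Calibrated.neighbours_le (h : Calibrated b c c' n m k₁ k₂ k r) (hb : 0 < b)
    (hc' : 0 ≤ c') (hn : 3 ≤ n) (hm : 3 ≤ m) :
    (k₁ : ℝ) ≤ c' * (((b + 5) ^ (2 / (b + 3))) ^ b * (n * rate b n m ^ b)) := by
  have hm0 : (0 : ℝ) < m := by exact_mod_cast (by omega : 0 < m)
  have hn0 : (0 : ℝ) < n := by exact_mod_cast (by omega : 0 < n)
  have hρ := rate_pos (b := b) (n := n) (m := m) (by omega)
  have hE := (one_le_log_natCast hn).trans (log_le_rate (m := m) hb hn)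
  have hl : 1 ≤ Real.log (n * m) := by
    have := one_le_log_natCast (n := n * m) (by nlinarith)
    exact_mod_cast this
  refine h.k₁_spec.upper hc' ?_ ?_
  · refine (neighbours_power_le hb hn0 hm0 (one_le_log_natCast hn) (by linarith)).trans ?_
    have h1 := Real.rpow_le_rpow (by
      have := one_le_log_natCast hn
      positivity) (flow_rate_le_rate hb hn hm) hb.le
    rw [Real.mul_rpow (by positivity) hρ.le] at h1
    calc _ ≤ (n : ℝ) * (((b + 5) ^ (2 / (b + 3))) ^ b * rate b n m ^ b) := by gcongr
      _ = _ := by ring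
  · have h1 : (1 : ℝ) ≤ ((b + 5) ^ (2 / (b + 3))) ^ b :=
      Real.one_le_rpow (Real.one_le_rpow (by linarith) (by positivity)) hb.le
    nlinarith

theorem Calibrated.times_le (h : Calibrated b c c' n m k₁ k₂ k r) (hb : 0 < b)
    (hc' : 0 ≤ c') (hn : 3 ≤ n) (hm : 3 ≤ m) :
    (k₂ : ℝ) ≤ c' * ((b + 5) ^ (2 / (b + 3)) * (m * rate b n m)) := by
  have hm0 : (0 : ℝ) < m := by exact_mod_cast (by omega : 0 < m)
  have hn0 : (0 : ℝ) < n := by exact_mod_cast (by omega : 0 < n)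
  have hl : 1 ≤ Real.log (n * m) := by
    have := one_le_log_natCast (n := n * m) (by nlinarith)
    exact_mod_cast this
  have hln := one_le_log_natCast hn
  refine h.k₂_spec.upper hc' ?_ ?_
  · rw [times_power_eq hb hn0 hm0 (by linarith) (by linarith), mul_left_comm]
    exact mul_le_mul_of_nonneg_left (flow_rate_le_rate hb hn hm) hm0.le
  · have h1 : (1 : ℝ) ≤ (b + 5) ^ (2 / (b + 3)) :=
      Real.one_le_rpow (by linarith) (by positivity)
    have := one_le_mul_rate (b := b) (n := n) (by omega : 0 < m)
    nlinarith

theorem Calibrated.deriv_noise_le (h : Calibrated b c c' n m k₁ k₂ k r) (hb : 0 < b) (hc : 0 < c)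
    (hn : 0 < n) (hm : 0 < m) :
    m / Real.sqrt (r * (k : ℝ) ^ 3) ≤ (c ^ 2)⁻¹ * rate b n m := by
  have hm0 : (0 : ℝ) < m := by exact_mod_cast hm
  have hn0 : (0 : ℝ) < n := by exact_mod_cast hn
  have hk : (0 : ℝ) < k := by exact_mod_cast h.k_spec.pos hc
  have hr : (0 : ℝ) < r := by exact_mod_cast h.r_spec.pos hc
  have hρ := rate_pos (b := b) (n := n) hm
  have h1 := h.r_spec.lower hc
  have h2 := h.k_spec.lower hc
  have h3 := variance_power_eq hb hn0 hm0
  set vr := (n : ℝ) ^ (5 / (5 + b)) / (m : ℝ) ^ (b / (5 + b)) with hvr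
  set vk := (m : ℝ) ^ ((4 + b) / (5 + b)) / (n : ℝ) ^ (1 / (5 + b)) with hvk
  have hvr0 : 0 < vr := by positivity
  have hvk0 : 0 < vk := by positivity
  rw [div_le_iff₀ (by positivity)]
  refine (sq_le_sq₀ (by positivity) (by positivity)).1 ?_
  rw [mul_pow, Real.sq_sqrt (by positivity)]
  calc (m : ℝ) ^ 2 = vr * vk ^ 3 * ((1 / ((n : ℝ) * m)) ^ (1 / (5 + b))) ^ 2 := h3.symm
    _ ≤ vr * vk ^ 3 * rate b n m ^ 2 := by gcongr; exact pow_le_rate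
    -- The lower bounds on r and k³ contribute c · c³, whose square root is c².
    _ = ((c ^ 2)⁻¹ * rate b n m) ^ 2 * ((c * vr) * (c * vk) ^ 3) := by field_simp
    _ ≤ _ := by gcongr

theorem Calibrated.flow_noise_le (h : Calibrated b c c' n m k₁ k₂ k r) (hb : 0 < b) (hc : 0 < c)
    (hn : 3 ≤ n) (hm : 3 ≤ m) :
    Real.sqrt (((k₁ : ℝ) * k₂)⁻¹) * Real.sqrt (Real.log (n * m))
      ≤ c⁻¹ * (b + 5) ^ (2 / (b + 3)) * rate b n m := by
  have hm0 : (0 : ℝ) < m := by exact_mod_cast (by omega : 0 < m)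
  have hn0 : (0 : ℝ) < n := by exact_mod_cast (by omega : 0 < n)
  have hl : 1 ≤ Real.log (n * m) := by
    have := one_le_log_natCast (n := n * m) (by nlinarith)
    exact_mod_cast this
  have hln := one_le_log_natCast hn
  have hk1 : (0 : ℝ) < k₁ := by exact_mod_cast h.k₁_spec.pos hc
  have hk2 : (0 : ℝ) < k₂ := by exact_mod_cast h.k₂_spec.pos hc
  have hρ := rate_pos (b := b) (n := n) (m := m) (by omega)
  have h1 := h.k₁_spec.lower hc
  have h2 := h.k₂_spec.lower hc
  have h3 := flow_variance_power_eq hb hn0 hm0 (by linarith : 0 < Real.log n)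
    (by linarith : 0 < Real.log (n * m))
  have h4 := flow_rate_le_rate hb hn hm
  set v₁ := ((n : ℝ) / Real.log n) ^ (3 / (b + 3)) / ((m : ℝ) / Real.log (n * m)) ^ (b / (b + 3))
  set v₂ := (m : ℝ) ^ ((b + 2) / (b + 3)) /
      ((n : ℝ) / (Real.log n * Real.log (n * m))) ^ (1 / (b + 3))
  set θ := (Real.log n * Real.log (n * m) / (n * m)) ^ (1 / (b + 3))
  have hv1 : 0 < v₁ := by positivity
  have hv2 : 0 < v₂ := by positivity
  have hθ : 0 < θ := by positivity
  rw [← Real.sqrt_mul (by positivity)]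
  refine Real.sqrt_le_iff.2 ⟨by positivity, ?_⟩
  rw [inv_mul_le_iff₀ (by positivity)]
  calc Real.log (n * m) = v₁ * v₂ * θ ^ 2 := h3.symm
    _ = (c * v₁) * (c * v₂) * (c⁻¹ * θ) ^ 2 := by field_simp
    _ ≤ k₁ * k₂ * (c⁻¹ * ((b + 5) ^ (2 / (b + 3)) * rate b n m)) ^ 2 := by gcongr
    _ = _ := by ring

/-- The rate tends to `0`. -/
theorem exists_forall_rate_le (hb : 0 < b) {ρ : ℝ} (hρ : 0 < ρ) :
    ∃ N : ℕ, 3 ≤ N ∧ ∀ n m : ℕ, N ≤ n → N ≤ m → rate b n m ≤ ρ := by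
  have t0 : Filter.Tendsto (fun n : ℕ => 1 / (n : ℝ)) Filter.atTop (nhds 0) :=
    tendsto_one_div_atTop_nhds_zero_nat
  have t1 : Filter.Tendsto (fun n : ℕ => (1 / (n : ℝ)) ^ (1 / (5 + b))) Filter.atTop (nhds 0) := by
    have := t0.rpow_const (p := 1 / (5 + b)) (Or.inr (by positivity))
    rwa [Real.zero_rpow (by positivity)] at this
  have t2 : Filter.Tendsto (fun n : ℕ => (Real.log n / n) ^ (1 / b)) Filter.atTop (nhds 0) := by
    have h : Filter.Tendsto (fun n : ℕ => Real.log n / n) Filter.atTop (nhds 0) :=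
      (Real.isLittleO_log_id_atTop.tendsto_div_nhds_zero).comp tendsto_natCast_atTop_atTop
    have := h.rpow_const (p := 1 / b) (Or.inr (by positivity))
    rwa [Real.zero_rpow (by positivity)] at this
  obtain ⟨N, hN⟩ := Filter.eventually_atTop.1 (((t0.eventually_le_const hρ).and
    (t1.eventually_le_const hρ)).and (t2.eventually_le_const hρ))
  refine ⟨max N 3, le_max_right _ _, fun n m hn hm => ?_⟩
  have hn3 : 3 ≤ n := (le_max_right _ _).trans hn
  have hm3 : 3 ≤ m := (le_max_right _ _).trans hm
  refine max_le (max_le ?_ (hN n ((le_max_left _ _).trans hn)).2)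
    (hN m ((le_max_left _ _).trans hm)).1.1
  refine le_trans ?_ (hN n ((le_max_left _ _).trans hn)).1.2
  have hn0 : (0 : ℝ) < n := by exact_mod_cast (by omega : 0 < n)
  have hm1 : (1 : ℝ) ≤ m := by exact_mod_cast (by omega : 1 ≤ m)
  gcongr
  nlinarith

/-- The probability of a deviation is negligible with respect to the rate. -/
theorem mul_exp_neg_le_rate (hb : 0 < b) (hn : 3 ≤ n) :
    n * Real.exp (-((1 + 1 / b) * (n * rate b n m ^ b))) ≤ rate b n m := by
  have hn0 : (0 : ℝ) < n := by exact_mod_cast (by omega : 0 < n)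
  have hE := log_le_rate (m := m) hb hn
  have hl := one_le_log_natCast hn
  have h1 : (Real.log n / n) ^ (1 / b) ≤ rate b n m := (le_max_right _ _).trans (le_max_left _ _)
  refine le_trans ?_ h1
  -- As nρ^b ≥ ln n, the left side is at most n · n^{-(1+1/b)} = n^{-1/b}.
  calc n * Real.exp (-((1 + 1 / b) * (n * rate b n m ^ b)))
      ≤ n * Real.exp (-((1 + 1 / b) * Real.log n)) := by gcongr
    _ = (1 / (n : ℝ)) ^ (1 / b) := by
        rw [Real.rpow_def_of_pos (by positivity), one_div (n : ℝ), Real.log_inv]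
        nth_rw 1 [← Real.exp_log hn0]
        rw [← Real.exp_add]
        congr 1
        ring
    _ ≤ _ := by gcongr

end Rates

end FlowRegression

/-! ### Choice of constants and assembly of the bound. -/

namespace FlowRegression

theorem lintegral_splitEst_le_rate (D : ℕ) (a b : ℝ) (ha : 0 < a) (hb : 0 < b)
    (L M : NNReal) (T σ : ℝ) (hT : 0 < T) (hσ : 0 < σ) (c c' : ℝ) (hc : 0 < c) (hcc' : c ≤ c') :
    ∃ (C : ℝ) (N₀ : ℕ), 0 < C ∧ 1 ≤ N₀ ∧
      ∀ n m : ℕ, N₀ ≤ n → N₀ ≤ m →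
      ∀ k₁ k₂ k r : ℕ, Calibrated b c c' n m k₁ k₂ k r →
      ∀ S : Selection D n m k₁ k₂ k r T,
      ∀ f ∈ LipClass D L M, ∀ μ ∈ StandardLaws D a b,
      ∀ x ∈ envelope f μ.support T,
        ∫⁻ U, ENNReal.ofReal ‖splitEst f S σ x U.1.1 U.1.2 U.2.1 U.2.2 - f x‖ ∂(splitLaw n m μ)
          ≤ ENNReal.ofReal (C * rate b n m) := by
  have hc' : 0 < c' := by linarith
  set Q : ℝ := (b + 5) ^ (2 / (b + 3)) with hQ
  have hQ0 : 0 < Q := by positivity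
  have hQb : 1 ≤ Q ^ b :=
    Real.one_le_rpow (Real.one_le_rpow (by linarith) (by positivity)) hb.le
  -- The 6 offsets the 1/2 of the Chernoff exponent and the 1/3 of n ≤ 3⌊n/2⌋. The first summand
  -- then cancels the required counts, the second leaves e^{-(1+1/b)nρ^b}.
  set K : ℝ := 6 * (c' * Q ^ b + (1 + 1 / b)) with hK
  have hK0 : 0 < K := by positivity
  -- The radius κρ is chosen to have guaranteed mass a(κρ)^b = Kρ^b.
  set κ : ℝ := (K / a) ^ (1 / b) with hκ
  have hκ0 : 0 < κ := by positivity
  have hκb : a * κ ^ b = K := by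
    rw [hκ, ← Real.rpow_mul (by positivity), one_div_mul_cancel hb.ne', Real.rpow_one]
    field_simp
  -- From N₀ on, Kρ^b ≤ 1, so the minimum with 1 in the mass condition is inactive.
  obtain ⟨N₀, hN3, hN⟩ := exists_forall_rate_le hb (ρ := (1 / K) ^ (1 / b)) (by positivity)
  set E : ℝ := Real.exp (L * T) with hE
  set C : ℝ := L * M * (c' * T) + L * ((E * κ + M * ((c' + 2) * T)) + 2 * (E * κ + M * (c' * Q * T)))
    + σ * (4 * D * (2 * (c ^ 2)⁻¹ / T)) + 2 * M * 2 + 2 * L * σ * (4 * D * (c⁻¹ * Q)) with hC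
  refine ⟨C + 1, N₀, by positivity, by omega, ?_⟩
  intro n m hn hm k₁ k₂ k r hcal S f hf μ hμ x hx
  obtain ⟨x₀, hx₀, t₀, ht₀, rfl⟩ := hx
  obtain ⟨hprob, hball⟩ := hμ
  have hn3 : 3 ≤ n := hN3.trans hn
  have hm3 : 3 ≤ m := hN3.trans hm
  have hn0 : (0 : ℝ) < n := by exact_mod_cast (by omega : 0 < n)
  have hm0 : (0 : ℝ) < m := by exact_mod_cast (by omega : 0 < m)
  have hk1 := hcal.k₁_spec.pos hc
  have hk2 := hcal.k₂_spec.pos hc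
  have hk := hcal.k_spec.pos hc
  have hr := hcal.r_spec.pos hc
  have b1 := hcal.steps_le hb hc'.le (by omega) (by omega)
  have b2 := hcal.trajectories_le hb hc'.le hn3 (by omega)
  have b3 := hcal.neighbours_le hb hc'.le hn3 hm3
  have b4 := hcal.times_le hb hc'.le hn3 hm3
  have b5 := hcal.deriv_noise_le hb hc (by omega) (by omega)
  have b6 := hcal.flow_noise_le hb hc hn3 hm3
  have b7 := mul_exp_neg_le_rate (b := b) hb hn3 (m := m)
  have b8 := one_le_mul_rate (b := b) (n := n) (m := m) (by omega)
  have hρ := rate_pos (b := b) (n := n) (m := m) (by omega)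
  have hsmall := hN n m hn hm
  rw [← hQ] at b3 b4 b6
  set ρ := rate b n m with hρdef
  have hpb : K * ρ ^ b ≤ 1 := by
    have h1 := Real.rpow_le_rpow hρ.le hsmall hb.le
    rw [← Real.rpow_mul (by positivity), one_div_mul_cancel hb.ne', Real.rpow_one] at h1
    rwa [le_div_iff₀ hK0, mul_comm] at h1
  have hp : a * (κ * ρ) ^ b = K * ρ ^ b := by
    rw [Real.mul_rpow hκ0.le hρ.le, ← mul_assoc, hκb]
  have hmass : ∀ z ∈ μ.support, ENNReal.ofReal (K * ρ ^ b)
      ≤ μ (Metric.closedBall z (κ * ρ)) := by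
    intro z hz
    have h := hball z hz (κ * ρ) (by positivity)
    rwa [hp, min_eq_left hpb] at h
  have hl : 1 ≤ Real.log (n * m) := by
    have := one_le_log_natCast (n := n * m) (by nlinarith)
    exact_mod_cast this
  have hmain := lintegral_splitEst_le S hf hT hσ hk1 hk2 hk hr hx₀ ht₀
    (R := κ * ρ) (p := K * ρ ^ b) (w := Real.sqrt (((k₁ : ℝ) * k₂)⁻¹))
    (q := Real.sqrt (Real.log (n * m))) (by positivity) hmass (by positivity)
    (by rw [Real.sq_sqrt (by positivity)]) (Real.one_le_sqrt.2 hl)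
    (by rw [Real.sq_sqrt (by linarith), Real.exp_log (by positivity)])
  refine hmain.trans (ENNReal.ofReal_le_ofReal ?_)
  have hdiv : ∀ {s t : ℝ}, s ≤ t * (m * ρ) → s * (T / m) ≤ t * T * ρ := by
    intro s t hst
    calc s * (T / m) ≤ t * (m * ρ) * (T / m) := by gcongr
      _ = t * T * ρ := by field_simp
  have hkT : k * (T / m) ≤ c' * T * ρ := hdiv b1
  -- The offset 2 is absorbed by 1 ≤ mρ.
  have hk2' : ((k : ℝ) + 2) * (T / m) ≤ (c' + 2) * T * ρ := hdiv (by linarith)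
  have hk2T : k₂ * (T / m) ≤ c' * Q * T * ρ := hdiv (by linarith)
  have hnoise : 2 * m / (T * Real.sqrt (r * (k : ℝ) ^ 3)) ≤ 2 * (c ^ 2)⁻¹ / T * ρ := by
    calc _ = 2 / T * (m / Real.sqrt (r * (k : ℝ) ^ 3)) := by
          rw [mul_comm T, mul_div_mul_comm, mul_comm, div_mul_div_comm, div_mul_div_comm, mul_comm 2]
      _ ≤ 2 / T * ((c ^ 2)⁻¹ * ρ) := by gcongr
      _ = _ := by ring
  have hfl : (n : ℝ) / 3 ≤ (n / 2 : ℕ) := by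
    have : n ≤ 3 * (n / 2) := by omega
    have : (n : ℝ) ≤ 3 * (n / 2 : ℕ) := by exact_mod_cast this
    linarith
  have hfl' : (n : ℝ) / 3 ≤ (n - n / 2 : ℕ) := by
    refine hfl.trans ?_
    exact_mod_cast (by omega : n / 2 ≤ n - n / 2)
  have hρb : 0 < ρ ^ b := by positivity
  have hexp : ∀ s N : ℕ, (s : ℝ) ≤ c' * (Q ^ b * (n * ρ ^ b)) → (n : ℝ) / 3 ≤ N →
      n * Real.exp (s - N * (K * ρ ^ b / 2)) ≤ ρ := by
    intro s N hs hNn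
    refine le_trans ?_ b7
    gcongr
    have : (n : ℝ) / 3 * (K * ρ ^ b / 2) ≤ N * (K * ρ ^ b / 2) := by gcongr
    have h2 : (n : ℝ) / 3 * (K * ρ ^ b / 2)
        = c' * (Q ^ b * (n * ρ ^ b)) + (1 + 1 / b) * (n * ρ ^ b) := by
      rw [hK]; ring
    linarith
  have hB1 : Real.exp (r - (n - n / 2 : ℕ) * (K * ρ ^ b / 2)) ≤ ρ := by
    refine le_trans ?_ (hexp r (n - n / 2) (b2.trans ?_) hfl')
    · refine le_mul_of_one_le_left (Real.exp_pos _).le ?_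
      exact_mod_cast (by omega : 1 ≤ n)
    · exact mul_le_mul_of_nonneg_left (le_mul_of_one_le_left (by positivity) hQb) hc'.le
  have hB2 := hexp k₁ (n / 2) b3 hfl
  calc _ ≤ L * M * (c' * T * ρ)
        + L * ((E * (κ * ρ) + M * ((c' + 2) * T * ρ)) + 2 * (E * (κ * ρ) + M * (c' * Q * T * ρ)))
        + σ * (4 * D * (2 * (c ^ 2)⁻¹ / T * ρ)) + 2 * M * (ρ + ρ)
        + 2 * L * σ * (4 * D * (c⁻¹ * Q * ρ)) := by gcongr
    _ = C * ρ := by rw [hC]; ring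
    _ ≤ _ := by gcongr; linarith

end FlowRegression

/-! ### Transfer to an arbitrary sample space. -/

open FlowRegression
theorem theorem1 (D : ℕ) (a b : ℝ) (ha : 0 < a) (hb : 0 < b) (hbD : b ≤ (D : ℝ) - 1)
    (L M : NNReal) (T σ : ℝ) (hT : 0 < T) (hσ : 0 < σ) (c c' : ℝ) (hc : 0 < c) (hcc' : c ≤ c') :
    ∃ (C : ℝ) (N₀ : ℕ), 0 < C ∧
      ∀ n m : ℕ, N₀ ≤ n → N₀ ≤ m →
      ∀ k₁ k₂ k r : ℕ, Calibrated b c c' n m k₁ k₂ k r →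
      ∀ S : Selection D n m k₁ k₂ k r T,
      ∀ f ∈ LipClass D L M, ∀ μ ∈ StandardLaws D a b,
      ∀ x ∈ envelope f μ.support T,
      ∀ (Ω : Type*) [MeasurableSpace Ω] (P : Measure Ω) [IsProbabilityMeasure P]
        (X : Fin n → Ω → Space D) (ε : Fin n → Fin m → Ω → Space D), IsSample P μ X ε →
        let fHat : Ω → Space D := fun ω =>
          fieldEst S (fun i => X i ω)
            (observations f T σ (fun i => X i ω) (fun i j => ε i j ω)) x
        Integrable (fun ω => ‖fHat ω - f x‖) P ∧
          ∫ ω, ‖fHat ω - f x‖ ∂P ≤ C * rate b n m := by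
  obtain ⟨C, N₀, hC, hN₀, h⟩ := lintegral_splitEst_le_rate D a b ha hb L M T σ hT hσ c c' hc hcc'
  refine ⟨C, N₀, hC, ?_⟩
  intro n m hn hm k₁ k₂ k r hcal S f hf μ hμ x hx Ω _ P _ X ε hsample fHat
  have hμ' := hμ.1
  have hlaw := hasLaw_splitLaw hsample
  set V : Ω → SplitData D n m := fun ω =>
    (((fun i => X (fstHalf i) ω), (fun i => X (sndHalf i) ω)),
      ((fun p : Fin (n / 2) × Fin m => ε (fstHalf p.1) p.2 ω),
        (fun p : Fin (n - n / 2) × Fin m => ε (sndHalf p.1) p.2 ω))) with hV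
  have hfHat : ∀ ω, fHat ω
      = splitEst f S σ x (V ω).1.1 (V ω).1.2 (V ω).2.1 (V ω).2.2 := fun ω => rfl
  have hmeas : Measurable fun U : SplitData D n m =>
      ‖splitEst f S σ x U.1.1 U.1.2 U.2.1 U.2.2 - f x‖ :=
    ((measurable_splitEst S hf hT σ x (measurable_fst.comp measurable_fst)
      (measurable_snd.comp measurable_fst) (measurable_fst.comp measurable_snd)
      (measurable_snd.comp measurable_snd)).sub_const (f x)).norm
  -- Bounding the lower integral first yields integrability and the bound on the expectation
  -- together.
  have hbound : ∫⁻ ω, ENNReal.ofReal ‖fHat ω - f x‖ ∂P ≤ ENNReal.ofReal (C * rate b n m) := by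
    simp_rw [hfHat]
    rw [hlaw.lintegral_comp (f := fun U : SplitData D n m =>
      ENNReal.ofReal ‖splitEst f S σ x U.1.1 U.1.2 U.2.1 U.2.2 - f x‖)
      hmeas.ennreal_ofReal.aemeasurable]
    exact h n m hn hm k₁ k₂ k r hcal S f hf μ hμ x hx
  have haesm : AEStronglyMeasurable (fun ω => ‖fHat ω - f x‖) P := by
    simp_rw [hfHat]
    exact (hmeas.comp_aemeasurable hlaw.aemeasurable).aestronglyMeasurable
  have hnn : ∀ ω, 0 ≤ ‖fHat ω - f x‖ := fun ω => norm_nonneg _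
  refine ⟨⟨haesm, ?_⟩, ?_⟩
  · rw [hasFiniteIntegral_iff_ofReal (Filter.Eventually.of_forall hnn)]
    exact hbound.trans_lt ENNReal.ofReal_lt_top
  · rw [integral_eq_lintegral_of_nonneg_ae (Filter.Eventually.of_forall hnn) haesm]
    refine ENNReal.toReal_le_of_le_ofReal ?_ hbound
    have := rate_pos (b := b) (n := n) (m := m) (by omega)
    positivity
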